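/- Let $C=[-\tfrac12,\tfrac12]^5\subset\mathbb{R}^5$ be the unit 5-cube. For a unit vector $u=(x_1,\dots,x_5)$, project $C$ orthogonally onto the hyperplane $u^\perp$, and let $mw(u)$ be the mean width of the image $P_u$ inside the 4-dimensional Euclidean space $u^\perp$, i.e. the average, over $v$ uniformly distributed on the unit sphere of $u^\perp$, of the width $\max_{p\in P_u}\langle v,p\rangle-\min_{p\in P_u}\langle v,p\rangle$. Then, for every unit vector $u$, $$mw(u)=\frac{4}{3\pi}\sum_{j=1}^5\sqrt{1-x_j^2}.$$ If $u$ is uniformly distributed on the unit sphere of $\mathbb{R}^5$, then $\mathbb{E}(mw)=\frac{15}{8}$ and $$\mathbb{E}(mw^2)=\frac{4}{81\pi^4}\left[144\pi^2-10\,\Gamma\!\left(\tfrac14\right)^4+45\pi^3\left(8\,{}_3F_2\!\left(-\tfrac12,\tfrac12,\tfrac32;1,2;1\right)-{}_3F_2\!\left(-\tfrac12,\tfrac12,\tfrac32;1,3;1\right)\right)\right]<1+\frac{8}{\pi},$$ where $${}_3F_2(a_1,a_2,a_3;b_1,b_2;z)=\frac{\Gamma(b_1)\Gamma(b_2)}{\Gamma(a_1)\Gamma(a_2)\Gamma(a_3)}\sum_{k=0}^\infty\frac{\Gamma(a_1+k)\Gamma(a_2+k)\Gamma(a_3+k)}{\Gamma(b_1+k)\Gamma(b_2+k)}\frac{z^k}{k!},$$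 both series being convergent. Moreover, over all unit vectors $u$, $\max(mw)=\frac{8\sqrt5}{3\pi}$ and $\min(mw)=\frac{16}{3\pi}$. -/

import Mathlib

open MeasureTheory

/-- The uniform probability measure on the unit sphere of a (nontrivial) Euclidean space:
normalized surface measure. -/
noncomputable def sphereUniform (E : Type*) [NormedAddCommGroup E] [InnerProductSpace ℝ E]
    [FiniteDimensional ℝ E] [MeasurableSpace E] [BorelSpace E] :
    Measure (Metric.sphere (0 : E) 1) :=
  ((volume : Measure E).toSphere Set.univ)⁻¹ • (volume : Measure E).toSphere

instance sphereUniform.instIsProbabilityMeasure (E : Type*) [NormedAddCommGroup E]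
    [InnerProductSpace ℝ E] [FiniteDimensional ℝ E] [MeasurableSpace E] [BorelSpace E]
    [Nontrivial E] : IsProbabilityMeasure (sphereUniform E) where
  measure_univ := by
    rw [sphereUniform, Measure.smul_apply, smul_eq_mul]
    refine ENNReal.inv_mul_cancel ?_ (measure_ne_top _ _)
    rw [Ne, Measure.measure_univ_eq_zero]
    exact Measure.toSphere_ne_zero _

/-- The width of a bounded set `K` in the direction `v`: the length of the interval spanned by
`⟪v, x⟫`, `x ∈ K`. -/
noncomputable def widthInDirection {E : Type*} [NormedAddCommGroup E] [InnerProductSpace ℝ E]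
    (K : Set E) (v : E) : ℝ :=
  sSup ((fun x => inner ℝ v x) '' K) - sInf ((fun x => inner ℝ v x) '' K)

/-- The mean width of a bounded set `K` in a Euclidean space `E`: the average of its width over
all unit directions of `E`. -/
noncomputable def meanWidth {E : Type*} [NormedAddCommGroup E] [InnerProductSpace ℝ E]
    [FiniteDimensional ℝ E] [MeasurableSpace E] [BorelSpace E] (K : Set E) : ℝ :=
  ∫ v : Metric.sphere (0 : E) 1, widthInDirection K (v : E) ∂(sphereUniform E)

/-- The cube in `ℝⁿ` with edges of unit length, centered at the origin. -/
def unitCube (n : ℕ) : Set (EuclideanSpace ℝ (Fin n)) :=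
  {x | ∀ i, |x i| ≤ 1 / 2}

/-- The orthogonal projection of the unit cube onto the hyperplane `u^⊥`, as a subset of that
hyperplane. -/
noncomputable def cubeShadow {n : ℕ} (u : EuclideanSpace ℝ (Fin n)) :
    Set (Submodule.orthogonal (Submodule.span ℝ {u})) :=
  (Submodule.orthogonal (Submodule.span ℝ {u})).orthogonalProjectionOnto '' unitCube n

/-- The mean width, measured inside the hyperplane `u^⊥`, of the projected cube. -/
noncomputable def shadowMeanWidth {n : ℕ} (u : EuclideanSpace ℝ (Fin n)) : ℝ :=
  meanWidth (cubeShadow u)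

/-- The `k`-th summand of the series in the definition of `₃F₂`. -/
noncomputable def hyp3F2Term (a₁ a₂ a₃ b₁ b₂ z : ℝ) (k : ℕ) : ℝ :=
  Real.Gamma (a₁ + k) * Real.Gamma (a₂ + k) * Real.Gamma (a₃ + k) /
    (Real.Gamma (b₁ + k) * Real.Gamma (b₂ + k)) * (z ^ k / (Nat.factorial k : ℝ))

/-- The generalized hypergeometric function `₃F₂(a₁, a₂, a₃; b₁, b₂; z)`. -/
noncomputable def hyp3F2 (a₁ a₂ a₃ b₁ b₂ z : ℝ) : ℝ :=
  Real.Gamma b₁ * Real.Gamma b₂ / (Real.Gamma a₁ * Real.Gamma a₂ * Real.Gamma a₃) *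
    ∑' k : ℕ, hyp3F2Term a₁ a₂ a₃ b₁ b₂ z k

/-! For v in the hyperplane orthogonal to u, pairing v with a projected point equals pairing v with
the point itself, so the shadow has width `∑ |v i|`. Each `|v i|` is `|⟪v, P eᵢ⟫|`, where P is the
projection and P eᵢ has length `√(1 - u i ^ 2)`. On the unit sphere of a 4-dimensional space the
mean of `|⟪v, p⟫|` is `4 / (3π) * ‖p‖`, which gives the formula for the mean width.

Spherical means of homogeneous functions are found by integrating against `exp (-‖x‖ ^ 2)` and
dividing out the radial factor (`integral_sphereUniform_eq`). With `√(‖x‖ ^ 2 - x i ^ 2)` in place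
of `√(1 - x i ^ 2)`, the first moment is a Gaussian moment of the norm in dimension 4.

The second moment needs the mean of a product of two such roots. Integrating out the three other
coordinates leaves a planar integral in p and q. Under p = sinh a, q = sinh b one has 1 + p² + q² =
cosh (a + b) cosh (a - b), so the integral separates into one-dimensional integrals of powers of
cosh. The value is a combination of A = `coshIntegral (1 / 2) ^ 2` and B = `coshIntegral (3 / 2) ^
2`.

The hypergeometric side reduces to the same A and B. Its terms are w³ times a rational function of
k, with w = `wallisRatio k`. By partial fractions only the sums of w³, w³/(k+1), w³/(1-2k) and
w³/(k+2) occur. The first two come from the binomial series of 1/√(1-x) summed under a planar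
integral, which the same substitution evaluates; the last two follow from telescoping relations.
Since A is Γ(1/4)⁴/(2π), both sides of the second moment formula agree.

The strict bound uses √A √B = 4π and estimates of Γ(1/4) from log-convexity. The extremes are
Cauchy–Schwarz and √t ≥ t on [0, 1]. -/

section

open Set Filter Topology
open scoped ENNReal

/-! ### Gamma, Gaussian and Beta integrals. -/

theorem lintegral_rpow_mul_exp_neg_mul_Ioi {b c : ℝ} (hb : 0 < b) (hc : 0 < c) :
    ∫⁻ t in Ioi (0 : ℝ), ENNReal.ofReal (t ^ (b - 1) * Real.exp (-(c * t))) =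
      ENNReal.ofReal (Real.Gamma b * c ^ (-b)) := by
  have h := Real.integral_rpow_mul_exp_neg_mul_Ioi hb hc
  have hpos : 0 < (1 / c) ^ b * Real.Gamma b :=
    mul_pos (Real.rpow_pos_of_pos (by positivity) _) (Real.Gamma_pos_of_pos hb)
  rw [← ofReal_integral_eq_lintegral_ofReal, h]
  · rw [mul_comm, one_div, Real.inv_rpow hc.le, Real.rpow_neg hc.le]
  -- A non-integrable function has Bochner integral 0, so the positive value found above already
  -- forces integrability.
  · by_contra hn
    rw [integral_undef hn] at h
    exact hpos.ne h
  · filter_upwards [self_mem_ae_restrict measurableSet_Ioi] with t ht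
    have : (0 : ℝ) < t := ht
    positivity

theorem lintegral_pow_mul_exp_neg_mul_sq_Ioi (m : ℕ) {c : ℝ} (hc : 0 < c) :
    ∫⁻ r in Ioi (0 : ℝ), ENNReal.ofReal (r ^ m * Real.exp (-(c * r ^ 2))) =
      ENNReal.ofReal (Real.Gamma (((m : ℝ) + 1) / 2) / 2 * c ^ (-(((m : ℝ) + 1) / 2))) := by
  have h := integral_rpow_mul_exp_neg_mul_rpow (p := 2) (q := m) two_pos
    (lt_of_lt_of_le (by norm_num) (Nat.cast_nonneg m)) hc
  have hm : 0 < Real.Gamma (((m : ℝ) + 1) / 2) := Real.Gamma_pos_of_pos (by positivity)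
  have hpos : 0 < c ^ (-((m : ℝ) + 1) / 2) * (1 / 2) * Real.Gamma (((m : ℝ) + 1) / 2) := by
    positivity
  have hfun : ∀ r ∈ Ioi (0 : ℝ), r ^ (m : ℝ) * Real.exp (-c * r ^ (2 : ℝ)) =
      r ^ m * Real.exp (-(c * r ^ 2)) := fun r _ => by
    rw [Real.rpow_natCast, Real.rpow_two, neg_mul]
  rw [setIntegral_congr_fun measurableSet_Ioi hfun] at h
  rw [← ofReal_integral_eq_lintegral_ofReal, h]
  · congr 1
    rw [neg_div]
    ring
  · by_contra hn
    rw [integral_undef hn] at h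
    exact hpos.ne h
  · filter_upwards [self_mem_ae_restrict measurableSet_Ioi] with t ht
    have : (0 : ℝ) < t := ht
    positivity

theorem lintegral_even_pow_mul_exp_neg_mul_sq (k : ℕ) {c : ℝ} (hc : 0 < c) :
    ∫⁻ y : ℝ, ENNReal.ofReal (y ^ (2 * k) * Real.exp (-(c * y ^ 2))) =
      ENNReal.ofReal (Real.Gamma ((k : ℝ) + 1 / 2) * c ^ (-((k : ℝ) + 1 / 2))) := by
  have h := lintegral_pow_mul_exp_neg_mul_sq_Ioi (2 * k) hc
  have hneg : ∫⁻ y in Iic (0 : ℝ), ENNReal.ofReal (y ^ (2 * k) * Real.exp (-(c * y ^ 2))) =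
      ∫⁻ y in Ioi (0 : ℝ), ENNReal.ofReal (y ^ (2 * k) * Real.exp (-(c * y ^ 2))) := by
    rw [← Measure.restrict_congr_set (Iio_ae_eq_Iic (a := (0 : ℝ)))]
    have := (Measure.measurePreserving_neg (volume : Measure ℝ)).setLIntegral_comp_preimage_emb
      (MeasurableEquiv.neg ℝ).measurableEmbedding
      (fun y => ENNReal.ofReal (y ^ (2 * k) * Real.exp (-(c * y ^ 2)))) (Ioi (0 : ℝ))
    rw [← this]
    simp [pow_mul]
  have hg : 0 < Real.Gamma ((k : ℝ) + 1 / 2) := Real.Gamma_pos_of_pos (by positivity)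
  have hk : (((2 * k : ℕ) : ℝ) + 1) / 2 = k + 1 / 2 := by push_cast; ring
  rw [hk] at h
  rw [← setLIntegral_univ, ← Iic_union_Ioi (a := (0 : ℝ)),
    lintegral_union measurableSet_Ioi (Iic_disjoint_Ioi le_rfl), hneg, h,
    ← ENNReal.ofReal_add (by positivity) (by positivity)]
  congr 1
  ring

/-- The Beta integral on the whole line. -/
theorem lintegral_even_pow_mul_one_add_sq_rpow_neg (k : ℕ) {b : ℝ} (hb : (k : ℝ) + 1 / 2 < b) :
    ∫⁻ y : ℝ, ENNReal.ofReal (y ^ (2 * k) * (1 + y ^ 2) ^ (-b)) =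
      ENNReal.ofReal (Real.Gamma ((k : ℝ) + 1 / 2) * Real.Gamma (b - k - 1 / 2) /
        Real.Gamma b) := by
  have hb0 : 0 < b := lt_trans (by positivity) hb
  have hgb : 0 < Real.Gamma b := Real.Gamma_pos_of_pos hb0
  have hgk : 0 < Real.Gamma ((k : ℝ) + 1 / 2) := Real.Gamma_pos_of_pos (by positivity)
  -- Γ(b) (1 + y²)^(-b) is written as a Gamma integral in t; after Tonelli the y-integral is
  -- Gaussian and the remaining t-integral is again Gamma.
  have key : ENNReal.ofReal (Real.Gamma b) *
      ∫⁻ y : ℝ, ENNReal.ofReal (y ^ (2 * k) * (1 + y ^ 2) ^ (-b)) =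
      ENNReal.ofReal (Real.Gamma ((k : ℝ) + 1 / 2) * Real.Gamma (b - k - 1 / 2)) := by
    calc _ = ∫⁻ y : ℝ, ∫⁻ t in Ioi (0 : ℝ), ENNReal.ofReal (y ^ (2 * k)) *
          ENNReal.ofReal (t ^ (b - 1) * Real.exp (-((1 + y ^ 2) * t))) := by
          rw [← lintegral_const_mul _ (by fun_prop)]
          refine lintegral_congr fun y => ?_
          have hy : 0 ≤ y ^ (2 * k) := by rw [pow_mul]; positivity
          rw [lintegral_const_mul _ (by fun_prop),
            lintegral_rpow_mul_exp_neg_mul_Ioi hb0 (by positivity),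
            ← ENNReal.ofReal_mul hgb.le, ← ENNReal.ofReal_mul hy]
          congr 1
          ring
      _ = ∫⁻ t in Ioi (0 : ℝ), ∫⁻ y : ℝ, ENNReal.ofReal (y ^ (2 * k)) *
          ENNReal.ofReal (t ^ (b - 1) * Real.exp (-((1 + y ^ 2) * t))) :=
          lintegral_lintegral_swap (by fun_prop)
      _ = ∫⁻ t in Ioi (0 : ℝ), ENNReal.ofReal (Real.Gamma ((k : ℝ) + 1 / 2)) *
          ENNReal.ofReal (t ^ ((b - k - 1 / 2) - 1) * Real.exp (-(1 * t))) := by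
          refine setLIntegral_congr_fun measurableSet_Ioi fun t (ht : 0 < t) => ?_
          have : ∀ y : ℝ, ENNReal.ofReal (y ^ (2 * k)) *
              ENNReal.ofReal (t ^ (b - 1) * Real.exp (-((1 + y ^ 2) * t))) =
              ENNReal.ofReal (t ^ (b - 1) * Real.exp (-t)) *
                ENNReal.ofReal (y ^ (2 * k) * Real.exp (-(t * y ^ 2))) := fun y => by
            have hy : 0 ≤ y ^ (2 * k) := by rw [pow_mul]; positivity
            rw [← ENNReal.ofReal_mul hy, ← ENNReal.ofReal_mul (by positivity),
              show -((1 + y ^ 2) * t) = -t + -(t * y ^ 2) by ring, Real.exp_add]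
            congr 1
            ring
          simp only [this]
          rw [lintegral_const_mul _ (by fun_prop),
            lintegral_even_pow_mul_exp_neg_mul_sq k ht, ← ENNReal.ofReal_mul (by positivity),
            ← ENNReal.ofReal_mul hgk.le]
          congr 1
          rw [show b - k - 1 / 2 - 1 = (b - 1) + -((k : ℝ) + 1 / 2) by ring,
            Real.rpow_add ht, one_mul]
          ring
      _ = _ := by
          rw [lintegral_const_mul _ (by fun_prop),
            lintegral_rpow_mul_exp_neg_mul_Ioi (by linarith) one_pos, Real.one_rpow, mul_one,
            ← ENNReal.ofReal_mul hgk.le]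
  rw [ENNReal.ofReal_div_of_pos hgb, ← key]
  refine (ENNReal.eq_div_iff ?_ ENNReal.ofReal_ne_top).2 rfl
  simpa using hgb

/-! ### Wallis ratios and the binomial series of 1/√(1 - x). -/

/-- The density `∏ (2 i + 1) / (2 i + 2)` of the central binomial coefficient. -/
noncomputable def wallisRatio (k : ℕ) : ℝ :=
  Real.Gamma ((k : ℝ) + 1 / 2) / (√Real.pi * (Nat.factorial k : ℝ))

theorem wallisRatio_pos (k : ℕ) : 0 < wallisRatio k :=
  div_pos (Real.Gamma_pos_of_pos (by positivity)) (by positivity)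

theorem wallisRatio_zero : wallisRatio 0 = 1 := by
  have : √Real.pi ≠ 0 := by positivity
  rw [wallisRatio, Nat.cast_zero, zero_add, Real.Gamma_one_half_eq]
  simp [this]

theorem wallisRatio_succ (k : ℕ) :
    wallisRatio (k + 1) = wallisRatio k * ((2 * k + 1) / (2 * k + 2)) := by
  have h : ((k + 1 : ℕ) : ℝ) + 1 / 2 = ((k : ℝ) + 1 / 2) + 1 := by push_cast; ring
  have hk : (k : ℝ) + 1 / 2 ≠ 0 := by positivity
  have hs : √Real.pi ≠ 0 := by positivity
  rw [wallisRatio, wallisRatio, h, Real.Gamma_add_one hk, Nat.factorial_succ]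
  push_cast
  field_simp

theorem Gamma_nat_add_half_eq_wallisRatio (k : ℕ) :
    Real.Gamma ((k : ℝ) + 1 / 2) = √Real.pi * (Nat.factorial k : ℝ) * wallisRatio k := by
  rw [wallisRatio]
  field_simp

theorem ascPochhammer_eval_half (k : ℕ) :
    (ascPochhammer ℝ k).eval (1 / 2 : ℝ) = (Nat.factorial k : ℝ) * wallisRatio k := by
  induction k with
  | zero => simp [wallisRatio_zero]
  | succ k ih =>
    rw [ascPochhammer_succ_eval, ih, wallisRatio_succ, Nat.factorial_succ]
    push_cast
    field_simp
    ring

/-- The left side is the form in which the power series of `1 / (1 - x) ^ (1 / 2)` presents its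
coefficients. -/
theorem choose_eq_wallisRatio (k : ℕ) :
    Ring.choose ((1 / 2 : ℝ) + k - 1) k = wallisRatio k := by
  have h := Ring.factorial_nsmul_multichoose_eq_ascPochhammer (1 / 2 : ℝ) k
  rw [Polynomial.ascPochhammer_smeval_eq_eval, ascPochhammer_eval_half, nsmul_eq_mul] at h
  have hk : (Nat.factorial k : ℝ) ≠ 0 := by positivity
  have h2 := mul_left_cancel₀ hk h
  rw [← h2, Ring.choose]
  congr 1
  ring

theorem hasSum_wallisRatio_mul_pow {x : ℝ} (hx : |x| < 1) :
    HasSum (fun k => wallisRatio k * x ^ k) (1 / √(1 - x)) := by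
  have h := (Real.one_div_one_sub_rpow_hasFPowerSeriesOnBall_zero (1 / 2)).hasSum
    (y := x) (by simpa [enorm_eq_nnnorm] using! hx)
  simp only [FormalMultilinearSeries.ofScalars_apply_eq, choose_eq_wallisRatio, zero_add,
    smul_eq_mul] at h
  rwa [Real.sqrt_eq_rpow]

/-! ### The hyperbolic substitution and integrals of powers of cosh. -/

theorem lintegral_comp_mul_left_real {c : ℝ} (hc : c ≠ 0) {f : ℝ → ℝ≥0∞} (hf : Measurable f) :
    ∫⁻ x, f (c * x) = ENNReal.ofReal |c⁻¹| * ∫⁻ x, f x := by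
  rw [← lintegral_map hf (measurable_const_mul c), Real.map_volume_mul_left hc,
    lintegral_smul_measure, smul_eq_mul]

theorem lintegral_eq_lintegral_sinh (f : ℝ → ℝ≥0∞) :
    ∫⁻ y, f y = ∫⁻ a, ENNReal.ofReal (Real.cosh a) * f (Real.sinh a) := by
  have h := lintegral_image_eq_lintegral_abs_deriv_mul (s := univ) MeasurableSet.univ
    (fun x _ => (Real.hasDerivAt_sinh x).hasDerivWithinAt) Real.sinh_injective.injOn f
  rw [image_univ, Real.sinh_surjective.range_eq] at h
  simpa [abs_of_pos (Real.cosh_pos _)] using h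

/-- Shear by s = a + b, so that a - b = s - 2b; for fixed s the affine map b ↦ s - 2b contributes
the factor 1/2. -/
theorem lintegral_lintegral_rotate {F : ℝ → ℝ → ℝ≥0∞} (hF : Measurable (Function.uncurry F)) :
    ∫⁻ a, ∫⁻ b, F (a + b) (a - b) = 2⁻¹ * ∫⁻ s, ∫⁻ t, F s t := by
  calc _ = ∫⁻ b, ∫⁻ a, F (a + b) (a - b) :=
        lintegral_lintegral_swap (f := fun a b : ℝ => F (a + b) (a - b))
          (hF.comp (f := fun p : ℝ × ℝ => (p.1 + p.2, p.1 - p.2)) (by fun_prop)).aemeasurable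
    _ = ∫⁻ b, ∫⁻ s, F s (s - 2 * b) := by
        refine lintegral_congr fun b => ?_
        rw [← lintegral_add_right_eq_self (fun s => F s (s - 2 * b)) b]
        refine lintegral_congr fun a => ?_
        congr 1
        ring
    _ = ∫⁻ s, ∫⁻ b, F s (s - 2 * b) :=
        lintegral_lintegral_swap (f := fun b s : ℝ => F s (s - 2 * b))
          (hF.comp (f := fun p : ℝ × ℝ => (p.2, p.2 - 2 * p.1)) (by fun_prop)).aemeasurable
    _ = ∫⁻ s, 2⁻¹ * ∫⁻ t, F s t := by
        refine lintegral_congr fun s => ?_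
        have hs : Measurable (F s) := hF.comp (measurable_const.prodMk measurable_id)
        have h := lintegral_comp_mul_left_real (c := -2) (by norm_num)
          (f := fun x => F s (s + x)) (hs.comp (measurable_const_add s))
        rw [lintegral_add_left_eq_self (F s) s] at h
        rw [show (2⁻¹ : ℝ≥0∞) = ENNReal.ofReal |(-2 : ℝ)⁻¹| by
          rw [show |(-2 : ℝ)⁻¹| = 2⁻¹ by norm_num [abs_of_neg], ENNReal.ofReal_inv_of_pos two_pos]
          simp, ← h]
        refine lintegral_congr fun b => ?_
        congr 1
        ring
    _ = _ := lintegral_const_mul' _ _ (by simp)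

theorem lintegral_lintegral_hyperbolic {H : ℝ → ℝ → ℝ}
    (hH : Measurable (Function.uncurry H)) :
    ∫⁻ p, ∫⁻ q, ENNReal.ofReal (H p q / (√(1 + p ^ 2) * √(1 + q ^ 2))) =
      ∫⁻ a, ∫⁻ b, ENNReal.ofReal (H (Real.sinh a) (Real.sinh b)) := by
  have hs : ∀ a, √(1 + Real.sinh a ^ 2) = Real.cosh a := fun a => by
    rw [← Real.cosh_sq', Real.sqrt_sq (Real.cosh_pos a).le]
  rw [lintegral_eq_lintegral_sinh]
  refine lintegral_congr fun a => ?_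
  rw [lintegral_eq_lintegral_sinh, ← lintegral_const_mul]
  · refine lintegral_congr fun b => ?_
    have ha := Real.cosh_pos a
    have hb := Real.cosh_pos b
    rw [← ENNReal.ofReal_mul hb.le, ← ENNReal.ofReal_mul ha.le, hs, hs]
    congr 1
    field_simp
  · have : Measurable (H (Real.sinh a)) := hH.comp (measurable_const.prodMk measurable_id)
    fun_prop

theorem one_add_sinh_sq_add_sinh_sq (a b : ℝ) :
    1 + Real.sinh a ^ 2 + Real.sinh b ^ 2 = Real.cosh (a + b) * Real.cosh (a - b) := by
  rw [Real.cosh_add, Real.cosh_sub]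
  have h1 := Real.cosh_sq' a
  have h2 := Real.cosh_sq' b
  linear_combination (-Real.cosh b ^ 2) * h1 - (1 + Real.sinh a ^ 2) * h2

theorem cosh_mul_cosh_eq (a b : ℝ) :
    Real.cosh a * Real.cosh b = (Real.cosh (a + b) + Real.cosh (a - b)) / 2 := by
  rw [Real.cosh_add, Real.cosh_sub]
  ring

/-- The value of `∫ cosh ^ (-a)` over the line. -/
noncomputable def coshIntegral (a : ℝ) : ℝ :=
  √Real.pi * Real.Gamma (a / 2) / Real.Gamma ((a + 1) / 2)

theorem coshIntegral_pos {a : ℝ} (ha : 0 < a) : 0 < coshIntegral a :=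
  div_pos (mul_pos (by positivity) (Real.Gamma_pos_of_pos (by positivity)))
    (Real.Gamma_pos_of_pos (by positivity))

theorem coshIntegral_add_two {a : ℝ} (ha : 0 < a) :
    coshIntegral (a + 2) = a / (a + 1) * coshIntegral a := by
  have h1 : (a + 2) / 2 = a / 2 + 1 := by ring
  have h2 : (a + 2 + 1) / 2 = (a + 1) / 2 + 1 := by ring
  have h3 := (Real.Gamma_pos_of_pos (show 0 < (a + 1) / 2 by positivity)).ne'
  rw [coshIntegral, coshIntegral, h1, h2, Real.Gamma_add_one (by positivity),
    Real.Gamma_add_one (by positivity)]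
  field_simp

theorem lintegral_cosh_rpow_neg {a : ℝ} (ha : 0 < a) :
    ∫⁻ s : ℝ, ENNReal.ofReal (Real.cosh s ^ (-a)) = ENNReal.ofReal (coshIntegral a) := by
  -- With y = sinh s, the exponent (a + 1)/2 gives cosh^(-a-1), and the Jacobian cosh s restores
  -- cosh^(-a).
  have h := lintegral_even_pow_mul_one_add_sq_rpow_neg 0 (b := (a + 1) / 2)
    (by push_cast; linarith)
  rw [lintegral_eq_lintegral_sinh] at h
  have h2 : Real.Gamma (((0 : ℕ) : ℝ) + 1 / 2) * Real.Gamma ((a + 1) / 2 - (0 : ℕ) - 1 / 2) /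
      Real.Gamma ((a + 1) / 2) = coshIntegral a := by
    rw [coshIntegral, Nat.cast_zero, zero_add, Real.Gamma_one_half_eq]
    congr 3
    ring
  rw [← h2, ← h]
  refine lintegral_congr fun s => ?_
  have hc := Real.cosh_pos s
  rw [← Real.cosh_sq', ← ENNReal.ofReal_mul hc.le, mul_zero, pow_zero, one_mul,
    ← Real.rpow_natCast, ← Real.rpow_mul hc.le, mul_comm, ← Real.rpow_add_one hc.ne']
  congr 2
  push_cast
  ring

theorem lintegral_lintegral_cosh_rpow {α β : ℝ} (hα : 0 < α) (hβ : 0 < β) :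
    ∫⁻ a : ℝ, ∫⁻ b : ℝ,
        ENNReal.ofReal (Real.cosh (a + b) ^ (-α) * Real.cosh (a - b) ^ (-β)) =
      ENNReal.ofReal (coshIntegral α * coshIntegral β / 2) := by
  have hm : ∀ γ : ℝ, Measurable fun s : ℝ => ENNReal.ofReal (Real.cosh s ^ (-γ)) := fun γ =>
    (Real.continuous_cosh.measurable.pow_const _).ennreal_ofReal
  have hsplit : ∀ s t : ℝ, ENNReal.ofReal (Real.cosh s ^ (-α) * Real.cosh t ^ (-β)) =
      ENNReal.ofReal (Real.cosh s ^ (-α)) * ENNReal.ofReal (Real.cosh t ^ (-β)) := fun s t =>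
    ENNReal.ofReal_mul (Real.rpow_nonneg (Real.cosh_pos _).le _)
  have h := lintegral_lintegral_rotate
    (F := fun s t => ENNReal.ofReal (Real.cosh s ^ (-α) * Real.cosh t ^ (-β)))
    (by
      simp only [hsplit]
      exact ((hm α).comp measurable_fst).mul ((hm β).comp measurable_snd))
  rw [h]
  simp only [hsplit]
  simp_rw [lintegral_const_mul _ (hm β), lintegral_mul_const _ (hm α),
    lintegral_cosh_rpow_neg hα, lintegral_cosh_rpow_neg hβ]
  rw [div_eq_inv_mul,
    ENNReal.ofReal_mul (by norm_num : (0 : ℝ) ≤ 2⁻¹), ENNReal.ofReal_inv_of_pos two_pos]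
  simp [ENNReal.ofReal_mul (coshIntegral_pos hα).le]

theorem cosh_mul_cosh_rpow (s t γ : ℝ) :
    (Real.cosh s * Real.cosh t) ^ γ = Real.cosh s ^ γ * Real.cosh t ^ γ :=
  Real.mul_rpow (Real.cosh_pos s).le (Real.cosh_pos t).le

theorem lintegral_lintegral_one_add_sinh_sq_rpow {γ : ℝ} (hγ : 0 < γ) :
    ∫⁻ a : ℝ, ∫⁻ b : ℝ, ENNReal.ofReal ((1 + Real.sinh a ^ 2 + Real.sinh b ^ 2) ^ (-γ)) =
      ENNReal.ofReal (coshIntegral γ ^ 2 / 2) := by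
  rw [sq, ← lintegral_lintegral_cosh_rpow hγ hγ]
  simp only [one_add_sinh_sq_add_sinh_sq, cosh_mul_cosh_rpow]

/-- Write r = 1 + sinh² a + sinh² b. By symmetry the doubled integral carries the weight sinh² a +
sinh² b; adding the integral of r^(-3/2) completes that weight to r, leaving r^(-1/2). -/
theorem lintegral_lintegral_sinh_sq_mul_rpow :
    2 * (∫⁻ a : ℝ, ∫⁻ b : ℝ, ENNReal.ofReal (Real.sinh b ^ 2 *
        (1 + Real.sinh a ^ 2 + Real.sinh b ^ 2) ^ (-(3 / 2 : ℝ)))) +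
      ENNReal.ofReal (coshIntegral (3 / 2) ^ 2 / 2) =
    ENNReal.ofReal (coshIntegral (1 / 2) ^ 2 / 2) := by
  have hr : Measurable fun p : ℝ × ℝ =>
      (1 + Real.sinh p.1 ^ 2 + Real.sinh p.2 ^ 2) ^ (-(3 / 2 : ℝ)) := by
    have : Continuous fun p : ℝ × ℝ => 1 + Real.sinh p.1 ^ 2 + Real.sinh p.2 ^ 2 := by fun_prop
    exact this.measurable.pow_const _
  have hr1 : ∀ a : ℝ, Measurable fun b : ℝ =>
      (1 + Real.sinh a ^ 2 + Real.sinh b ^ 2) ^ (-(3 / 2 : ℝ)) := fun a =>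
    hr.comp (f := fun b : ℝ => (a, b)) (by fun_prop)
  have hsw : ∫⁻ a : ℝ, ∫⁻ b : ℝ, ENNReal.ofReal (Real.sinh b ^ 2 *
        (1 + Real.sinh a ^ 2 + Real.sinh b ^ 2) ^ (-(3 / 2 : ℝ))) =
      ∫⁻ a : ℝ, ∫⁻ b : ℝ, ENNReal.ofReal (Real.sinh a ^ 2 *
        (1 + Real.sinh a ^ 2 + Real.sinh b ^ 2) ^ (-(3 / 2 : ℝ))) := by
    rw [lintegral_lintegral_swap]
    · refine lintegral_congr fun a => lintegral_congr fun b => ?_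
      congr 3
      ring
    · refine (Measurable.ennreal_ofReal (Measurable.mul ?_ hr)).aemeasurable
      fun_prop
  have hm1 : Measurable fun p : ℝ × ℝ => ENNReal.ofReal (Real.sinh p.2 ^ 2 *
        (1 + Real.sinh p.1 ^ 2 + Real.sinh p.2 ^ 2) ^ (-(3 / 2 : ℝ))) :=
    Measurable.ennreal_ofReal (Measurable.mul (by fun_prop) hr)
  have hm2 : Measurable fun p : ℝ × ℝ => ENNReal.ofReal (Real.sinh p.1 ^ 2 *
        (1 + Real.sinh p.1 ^ 2 + Real.sinh p.2 ^ 2) ^ (-(3 / 2 : ℝ))) :=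
    Measurable.ennreal_ofReal (Measurable.mul (by fun_prop) hr)
  rw [two_mul]
  nth_rewrite 2 [hsw]
  rw [← lintegral_lintegral_one_add_sinh_sq_rpow (γ := 3 / 2) (by norm_num),
    ← lintegral_lintegral_one_add_sinh_sq_rpow (γ := 1 / 2) (by norm_num),
    ← lintegral_add_left hm1.lintegral_prod_right, ← lintegral_add_left]
  · refine lintegral_congr fun a => ?_
    have hma : Measurable fun b : ℝ => ENNReal.ofReal (Real.sinh b ^ 2 *
        (1 + Real.sinh a ^ 2 + Real.sinh b ^ 2) ^ (-(3 / 2 : ℝ))) :=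
      Measurable.ennreal_ofReal (Measurable.mul (by fun_prop) (hr1 a))
    rw [← lintegral_add_left hma, ← lintegral_add_left]
    · refine lintegral_congr fun b => ?_
      have hpos : 0 < 1 + Real.sinh a ^ 2 + Real.sinh b ^ 2 := by positivity
      rw [← ENNReal.ofReal_add (by positivity) (by positivity),
        ← ENNReal.ofReal_add (by positivity) (by positivity)]
      congr 1
      rw [show (-(1 / 2) : ℝ) = -(3 / 2) + 1 by norm_num, Real.rpow_add_one hpos.ne']
      ring
    · have := hr1 a
      fun_prop
  · exact Measurable.add hm1.lintegral_prod_right hm2.lintegral_prod_right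

/-! ### Cubic Wallis series as planar integrals. -/

theorem lintegral_lintegral_wallisRatio_sq (k j : ℕ) :
    ∫⁻ y : ℝ, ∫⁻ z : ℝ, ENNReal.ofReal (y ^ (2 * k) * z ^ (2 * j) /
        ((1 + y ^ 2 + z ^ 2) ^ (k + j + 1) * √(1 + y ^ 2))) =
      ENNReal.ofReal (Real.Gamma ((k : ℝ) + 1 / 2) ^ 2 * √Real.pi * Real.Gamma ((j : ℝ) + 1 / 2) /
        ((Nat.factorial k : ℝ) * (Nat.factorial (k + j) : ℝ))) := by
  have hgk : 0 < Real.Gamma ((k : ℝ) + 1 / 2) := Real.Gamma_pos_of_pos (by positivity)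
  have hgj : 0 < Real.Gamma ((j : ℝ) + 1 / 2) := Real.Gamma_pos_of_pos (by positivity)
  have h1 := lintegral_even_pow_mul_one_add_sq_rpow_neg k (b := k + 1) (by linarith)
  have h2 := lintegral_even_pow_mul_one_add_sq_rpow_neg j (b := k + j + 1)
    (by have : (0 : ℝ) ≤ k := Nat.cast_nonneg k
        linarith)
  rw [show (k : ℝ) + 1 - k - 1 / 2 = 1 / 2 by ring, Real.Gamma_one_half_eq,
    Real.Gamma_nat_eq_factorial] at h1
  rw [show (k : ℝ) + j + 1 - j - 1 / 2 = k + 1 / 2 by ring, ← Nat.cast_add,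
    Real.Gamma_nat_eq_factorial] at h2
  -- The scaling z = √(1 + y²) c factors 1 + y² + z² as (1 + y²)(1 + c²), so the double integral is
  -- a product of two Beta integrals.
  have inner : ∀ y : ℝ, ∫⁻ z : ℝ, ENNReal.ofReal (y ^ (2 * k) * z ^ (2 * j) /
        ((1 + y ^ 2 + z ^ 2) ^ (k + j + 1) * √(1 + y ^ 2))) =
      ENNReal.ofReal (y ^ (2 * k) * (1 + y ^ 2) ^ (-((k : ℝ) + 1))) *
        ∫⁻ c : ℝ, ENNReal.ofReal (c ^ (2 * j) * (1 + c ^ 2) ^ (-(((k + j : ℕ) : ℝ) + 1))) := by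
    intro y
    have hy : 0 ≤ y ^ (2 * k) := by rw [pow_mul]; positivity
    have hm : 0 < 1 + y ^ 2 := by positivity
    have hs : 0 < √(1 + y ^ 2) := Real.sqrt_pos.2 hm
    have hsc := lintegral_comp_mul_left_real hs.ne'
      (f := fun z => ENNReal.ofReal (y ^ (2 * k) * z ^ (2 * j) /
        ((1 + y ^ 2 + z ^ 2) ^ (k + j + 1) * √(1 + y ^ 2)))) (by fun_prop)
    have hinv : ENNReal.ofReal √(1 + y ^ 2) * ENNReal.ofReal |(√(1 + y ^ 2))⁻¹| = 1 := by
      rw [← ENNReal.ofReal_mul hs.le, abs_of_pos (by positivity), mul_inv_cancel₀ hs.ne',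
        ENNReal.ofReal_one]
    rw [← one_mul (∫⁻ z : ℝ, _), ← hinv, mul_assoc, ← hsc, ← lintegral_const_mul _ (by fun_prop),
      ← lintegral_const_mul _ (by fun_prop)]
    refine lintegral_congr fun c => ?_
    rw [← ENNReal.ofReal_mul hs.le, ← ENNReal.ofReal_mul (by positivity)]
    congr 1
    rw [mul_pow _ c 2, Real.sq_sqrt hm.le, mul_pow _ c, pow_mul √(1 + y ^ 2), Real.sq_sqrt hm.le,
      show 1 + y ^ 2 + (1 + y ^ 2) * c ^ 2 = (1 + y ^ 2) * (1 + c ^ 2) by ring, mul_pow,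
      Real.rpow_neg (by positivity), Real.rpow_neg (by positivity),
      show (k : ℝ) + 1 = ((k + 1 : ℕ) : ℝ) by push_cast; ring,
      show ((k + j : ℕ) : ℝ) + 1 = ((k + j + 1 : ℕ) : ℝ) by push_cast; ring,
      Real.rpow_natCast, Real.rpow_natCast]
    have hc : 0 < 1 + c ^ 2 := by positivity
    field_simp
    ring
  simp only [inner]
  rw [lintegral_mul_const _ (by fun_prop), h1, h2, ← ENNReal.ofReal_mul (by positivity)]
  congr 1
  field_simp

/-- Sum the binomial series at x = y²/(1 + y² + z²) under the integral. Since 1 - x = (1 + z²)/(1 +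
y² + z²), the sum supplies the missing 1/√(1 + z²), and 1/(√(1 + y²) √(1 + z²)) is exactly the
weight removed by y = sinh a, z = sinh b. The cases j = 0 and j = 1 give the sums of w³ and
w³/(k+1). -/
theorem tsum_wallisRatio_lintegral (j : ℕ) :
    ∑' k : ℕ, ENNReal.ofReal (wallisRatio k * (Real.Gamma ((k : ℝ) + 1 / 2) ^ 2 * √Real.pi *
        Real.Gamma ((j : ℝ) + 1 / 2) / ((Nat.factorial k : ℝ) * (Nat.factorial (k + j) : ℝ)))) =
      ∫⁻ a : ℝ, ∫⁻ b : ℝ, ENNReal.ofReal (Real.sinh b ^ (2 * j) *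
        (1 + Real.sinh a ^ 2 + Real.sinh b ^ 2) ^ (-((j : ℝ) + 1 / 2))) := by
  have hmeas : Measurable (Function.uncurry fun y z : ℝ => z ^ (2 * j) *
      (1 + y ^ 2 + z ^ 2) ^ (-((j : ℝ) + 1 / 2))) := by
    have h : Continuous fun p : ℝ × ℝ => 1 + p.1 ^ 2 + p.2 ^ 2 := by fun_prop
    exact Measurable.mul (by fun_prop) (h.measurable.pow_const _)
  rw [← lintegral_lintegral_hyperbolic hmeas]
  have hterm : ∀ k : ℕ, ENNReal.ofReal (wallisRatio k * (Real.Gamma ((k : ℝ) + 1 / 2) ^ 2 *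
      √Real.pi * Real.Gamma ((j : ℝ) + 1 / 2) /
        ((Nat.factorial k : ℝ) * (Nat.factorial (k + j) : ℝ)))) =
      ∫⁻ y : ℝ, ∫⁻ z : ℝ, ENNReal.ofReal (wallisRatio k * (y ^ (2 * k) * z ^ (2 * j) /
        ((1 + y ^ 2 + z ^ 2) ^ (k + j + 1) * √(1 + y ^ 2)))) := fun k => by
    have hw := (wallisRatio_pos k).le
    simp_rw [ENNReal.ofReal_mul hw]
    rw [← lintegral_lintegral_wallisRatio_sq, ← lintegral_const_mul']
    · refine lintegral_congr fun y => ?_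
      rw [← lintegral_const_mul' _ _ ENNReal.ofReal_ne_top]
    · exact ENNReal.ofReal_ne_top
  have hm : ∀ k : ℕ, Measurable fun p : ℝ × ℝ => ENNReal.ofReal (wallisRatio k *
      (p.1 ^ (2 * k) * p.2 ^ (2 * j) /
        ((1 + p.1 ^ 2 + p.2 ^ 2) ^ (k + j + 1) * √(1 + p.1 ^ 2)))) := fun k => by fun_prop
  simp only [hterm]
  rw [← lintegral_tsum fun k => (hm k).lintegral_prod_right.aemeasurable]
  refine lintegral_congr fun y => ?_
  rw [← lintegral_tsum fun k => Measurable.aemeasurable (by fun_prop)]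
  refine lintegral_congr fun z => ?_
  have hy : 0 < 1 + y ^ 2 := by positivity
  have hz : 0 < 1 + z ^ 2 := by positivity
  have hr : 0 < 1 + y ^ 2 + z ^ 2 := by positivity
  have hx : |y ^ 2 / (1 + y ^ 2 + z ^ 2)| < 1 := by
    rw [abs_of_nonneg (by positivity), div_lt_one hr]
    linarith [sq_nonneg z]
  have hsum := (hasSum_wallisRatio_mul_pow hx).mul_right
    (z ^ (2 * j) / ((1 + y ^ 2 + z ^ 2) ^ (j + 1) * √(1 + y ^ 2)))
  have hj : 0 ≤ z ^ (2 * j) := by rw [pow_mul]; positivity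
  have heq : ∀ k : ℕ, wallisRatio k * (y ^ 2 / (1 + y ^ 2 + z ^ 2)) ^ k *
      (z ^ (2 * j) / ((1 + y ^ 2 + z ^ 2) ^ (j + 1) * √(1 + y ^ 2))) =
      wallisRatio k * (y ^ (2 * k) * z ^ (2 * j) /
        ((1 + y ^ 2 + z ^ 2) ^ (k + j + 1) * √(1 + y ^ 2))) := fun k => by
    rw [div_pow, ← pow_mul, add_assoc k j 1, pow_add _ k (j + 1)]
    have hs : 0 < √(1 + y ^ 2) := Real.sqrt_pos.2 hy
    field_simp
  simp only [heq] at hsum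
  rw [← ENNReal.ofReal_tsum_of_nonneg (fun k => ?_) hsum.summable, hsum.tsum_eq]
  · congr 1
    rw [show 1 - y ^ 2 / (1 + y ^ 2 + z ^ 2) = (1 + z ^ 2) / (1 + y ^ 2 + z ^ 2) by
      field_simp; ring, Real.sqrt_div hz.le, one_div_div,
      show (-((j : ℝ) + 1 / 2)) = 1 / 2 + -((j + 1 : ℕ) : ℝ) by push_cast; ring,
      Real.rpow_add hr, ← Real.sqrt_eq_rpow, Real.rpow_neg hr.le, Real.rpow_natCast]
    have hs : 0 < √(1 + y ^ 2) := Real.sqrt_pos.2 hy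
    have hs' : 0 < √(1 + z ^ 2) := Real.sqrt_pos.2 hz
    field_simp
  · have hy : 0 ≤ y ^ (2 * k) := by rw [pow_mul]; positivity
    exact mul_nonneg (wallisRatio_pos k).le (by positivity)

/-- Finiteness of the extended sum yields convergence together with the value, so no separate
estimate of the terms is needed. -/
theorem hasSum_of_tsum_ofReal_eq {f : ℕ → ℝ} (hf : ∀ k, 0 ≤ f k) {S : ℝ} (hS : 0 ≤ S)
    (h : ∑' k, ENNReal.ofReal (f k) = ENNReal.ofReal S) : HasSum f S := by
  have hs : Summable f := by
    have := ENNReal.summable_toReal (f := fun k => ENNReal.ofReal (f k)) (by rw [h]; simp)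
    simpa [ENNReal.toReal_ofReal, hf] using this
  have h2 := ENNReal.ofReal_tsum_of_nonneg hf hs
  rw [h, ENNReal.ofReal_eq_ofReal_iff (tsum_nonneg hf) hS] at h2
  exact h2 ▸ hs.hasSum

theorem hasSum_wallisRatio_cube :
    HasSum (fun k => wallisRatio k ^ 3) (coshIntegral (1 / 2) ^ 2 / (2 * Real.pi ^ 2)) := by
  have h := tsum_wallisRatio_lintegral 0
  simp only [Nat.cast_zero, mul_zero, pow_zero, one_mul, zero_add, add_zero] at h
  rw [lintegral_lintegral_one_add_sinh_sq_rpow (by norm_num)] at h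
  have h2 := hasSum_of_tsum_ofReal_eq (fun k => by
    have := wallisRatio_pos k
    have : 0 < Real.Gamma (1 / 2) := Real.Gamma_pos_of_pos (by norm_num)
    positivity) (by positivity) h
  have hpi := Real.pi_pos
  have hsq : √Real.pi ^ 2 = Real.pi := Real.sq_sqrt hpi.le
  convert! h2.mul_right (Real.pi ^ 2)⁻¹ using 1
  · funext k
    rw [Gamma_nat_add_half_eq_wallisRatio, Real.Gamma_one_half_eq]
    have hk : (Nat.factorial k : ℝ) ≠ 0 := by positivity
    field_simp
    linear_combination wallisRatio k ^ 3 * (-(√Real.pi ^ 2) - Real.pi) * hsq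
  · field_simp

theorem hasSum_wallisRatio_cube_div_add_one :
    HasSum (fun k : ℕ => wallisRatio k ^ 3 / (k + 1))
      ((coshIntegral (1 / 2) ^ 2 - coshIntegral (3 / 2) ^ 2) / (2 * Real.pi ^ 2)) := by
  have h := tsum_wallisRatio_lintegral 1
  have hX := lintegral_lintegral_sinh_sq_mul_rpow
  rw [show (((1 : ℕ) : ℝ) + 1 / 2) = 3 / 2 by norm_num, mul_one] at h
  set X := ∫⁻ a : ℝ, ∫⁻ b : ℝ, ENNReal.ofReal (Real.sinh b ^ 2 *
        (1 + Real.sinh a ^ 2 + Real.sinh b ^ 2) ^ (-(3 / 2 : ℝ))) with hXdef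
  have hXtop : X ≠ ∞ := by
    rintro hX'
    rw [hX'] at hX
    simp at hX
  have hXr : X = ENNReal.ofReal X.toReal := (ENNReal.ofReal_toReal hXtop).symm
  have hval : X.toReal = (coshIntegral (1 / 2) ^ 2 - coshIntegral (3 / 2) ^ 2) / 4 := by
    have h' := congrArg ENNReal.toReal hX
    rw [ENNReal.toReal_add (ENNReal.mul_ne_top (by simp) hXtop) ENNReal.ofReal_ne_top,
      ENNReal.toReal_mul, ENNReal.toReal_ofReal (by positivity),
      ENNReal.toReal_ofReal (by positivity)] at h'
    simp only [ENNReal.toReal_ofNat] at h'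
    linarith
  rw [hXr] at h
  have h2 := hasSum_of_tsum_ofReal_eq (fun k => by
    have := wallisRatio_pos k
    have : 0 < Real.Gamma (3 / 2) := Real.Gamma_pos_of_pos (by norm_num)
    positivity) ENNReal.toReal_nonneg h
  rw [hval] at h2
  have hpi := Real.pi_pos
  have hsq : √Real.pi ^ 2 = Real.pi := Real.sq_sqrt hpi.le
  convert! h2.mul_right (2 * (Real.pi ^ 2)⁻¹) using 1
  · funext k
    rw [Gamma_nat_add_half_eq_wallisRatio, show (3 / 2 : ℝ) = 1 / 2 + 1 by norm_num,
      Real.Gamma_add_one (by norm_num), Real.Gamma_one_half_eq, Nat.factorial_succ]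
    have hk : (Nat.factorial k : ℝ) ≠ 0 := by positivity
    push_cast
    field_simp
    linear_combination wallisRatio k ^ 3 * (-(√Real.pi ^ 2) - Real.pi) * hsq
  · field_simp
    ring

/-! ### Telescoping relations between the cubic series. -/

theorem wallisRatio_sq_mul_le (k : ℕ) : wallisRatio k ^ 2 * (2 * k + 1) ≤ 1 := by
  induction k with
  | zero => simp [wallisRatio_zero]
  | succ k ih =>
    rw [wallisRatio_succ]
    push_cast
    have h : (wallisRatio k * ((2 * k + 1) / (2 * k + 2))) ^ 2 * (2 * (k + 1) + 1) =
        wallisRatio k ^ 2 * (2 * k + 1) * ((2 * k + 1) * (2 * k + 3) / (2 * k + 2) ^ 2) := by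
      field_simp
      ring
    -- This is the ratio of consecutive values, so the sequence decreases from its value 1 at k = 0.
    have h2 : ((2 * k + 1) * (2 * k + 3) / (2 * k + 2) ^ 2 : ℝ) ≤ 1 := by
      rw [div_le_one (by positivity)]
      nlinarith
    rw [h]
    exact mul_le_one₀ ih (by positivity) h2

theorem tendsto_wallisRatio : Tendsto wallisRatio atTop (𝓝 0) := by
  have h1 : Tendsto (fun k : ℕ => √(1 / ((k : ℝ) + 1))) atTop (𝓝 0) := by
    simpa using tendsto_one_div_add_atTop_nhds_zero_nat.sqrt
  refine squeeze_zero (fun k => (wallisRatio_pos k).le) (fun k => ?_) h1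
  refine Real.le_sqrt_of_sq_le ?_
  rw [le_div_iff₀ (by positivity)]
  refine le_trans ?_ (wallisRatio_sq_mul_le k)
  gcongr
  linarith [(Nat.cast_nonneg k : (0 : ℝ) ≤ k)]

/-- Telescoping sums with the certificate `q k * w k ^ 3`, where `q` grows at most linearly. -/
theorem hasSum_wallisRatio_telescope {q : ℕ → ℝ} (hq0 : q 0 = 0)
    (hq : ∀ k, |q k| ≤ 2 * k + 1) (hs : Summable fun k => wallisRatio k ^ 3 *
      (((2 * k + 1) / (2 * k + 2)) ^ 3 * q (k + 1) - q k)) :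
    HasSum (fun k : ℕ => wallisRatio k ^ 3 *
      (((2 * k + 1) / (2 * k + 2)) ^ 3 * q (k + 1) - q k)) 0 := by
  rw [hs.hasSum_iff_tendsto_nat]
  have h1 : ∀ n : ℕ, ∑ k ∈ Finset.range n, wallisRatio k ^ 3 *
      (((2 * (k : ℝ) + 1) / (2 * k + 2)) ^ 3 * q (k + 1) - q k) = q n * wallisRatio n ^ 3 := by
    intro n
    rw [← sub_zero (q n * wallisRatio n ^ 3), ← zero_mul (wallisRatio 0 ^ 3), ← hq0,
      ← Finset.sum_range_sub fun k => q k * wallisRatio k ^ 3]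
    refine Finset.sum_congr rfl fun k _ => ?_
    rw [wallisRatio_succ]
    ring
  simp only [h1]
  -- The boundary term vanishes: w² absorbs the linear growth of q and one factor w remains.
  refine squeeze_zero_norm (fun k => ?_) tendsto_wallisRatio
  have hw := wallisRatio_pos k
  rw [Real.norm_eq_abs, abs_mul, abs_of_pos (pow_pos hw 3)]
  calc |q k| * wallisRatio k ^ 3 ≤ (2 * k + 1) * wallisRatio k ^ 3 := by gcongr; exact hq k
    _ = wallisRatio k ^ 2 * (2 * k + 1) * wallisRatio k := by ring
    _ ≤ 1 * wallisRatio k := by gcongr; exact wallisRatio_sq_mul_le k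
    _ = wallisRatio k := one_mul _

theorem two_mul_sub_one_abs_ge_one (k : ℕ) : 1 ≤ |1 - 2 * (k : ℝ)| := by
  rcases Nat.eq_zero_or_pos k with rfl | hk
  · simp
  · have : (1 : ℝ) ≤ k := by exact_mod_cast hk
    rw [abs_of_nonpos (by linarith)]
    linarith

theorem one_sub_two_mul_ne_zero (k : ℕ) : 1 - 2 * (k : ℝ) ≠ 0 := by
  have := two_mul_sub_one_abs_ge_one k
  intro h
  rw [h, abs_zero] at this
  linarith

theorem summable_wallisRatio_cube_mul {r : ℕ → ℝ} (hr : ∀ k, |r k| ≤ 1) :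
    Summable fun k => wallisRatio k ^ 3 * r k := by
  refine Summable.of_norm_bounded hasSum_wallisRatio_cube.summable fun k => ?_
  have hw := wallisRatio_pos k
  rw [Real.norm_eq_abs, abs_mul, abs_of_pos (pow_pos hw 3)]
  exact mul_le_of_le_one_right (by positivity) (hr k)

theorem summable_wallisRatio_cube_div_one_sub :
    Summable fun k : ℕ => wallisRatio k ^ 3 * (1 - 2 * (k : ℝ))⁻¹ :=
  summable_wallisRatio_cube_mul fun k => by
    rw [abs_inv]
    exact inv_le_one_of_one_le₀ (two_mul_sub_one_abs_ge_one k)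

theorem summable_wallisRatio_cube_div_add_two :
    Summable fun k : ℕ => wallisRatio k ^ 3 * ((k : ℝ) + 2)⁻¹ :=
  summable_wallisRatio_cube_mul fun k => by
    rw [abs_of_pos (by positivity)]
    exact inv_le_one_of_one_le₀ (by linarith [(Nat.cast_nonneg k : (0 : ℝ) ≤ k)])

/-- The certificate is q(k) = k²/(2k - 1): the numerator of q(k+1) lowers (k+1)³ to a simple pole,
and its denominator cancels one factor 2k + 1. The telescoped relation is S₂/8 - S₀/4 + S₁/4 = 0. -/
theorem hasSum_wallisRatio_cube_div_one_sub {S₀ S₂ : ℝ}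
    (h0 : HasSum (fun k => wallisRatio k ^ 3) S₀)
    (h2 : HasSum (fun k : ℕ => wallisRatio k ^ 3 / (k + 1)) S₂) :
    HasSum (fun k : ℕ => wallisRatio k ^ 3 * (1 - 2 * (k : ℝ))⁻¹) (S₀ - S₂ / 2) := by
  have hs := summable_wallisRatio_cube_div_one_sub.hasSum
  set S₁ := ∑' k : ℕ, wallisRatio k ^ 3 * (1 - 2 * (k : ℝ))⁻¹
  have hc := ((h2.mul_left (1 / 8)).sub (h0.mul_left (1 / 4))).add (hs.mul_left (1 / 4))
  have heq : ∀ k : ℕ, 1 / 8 * (wallisRatio k ^ 3 / (k + 1)) - 1 / 4 * wallisRatio k ^ 3 +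
      1 / 4 * (wallisRatio k ^ 3 * (1 - 2 * (k : ℝ))⁻¹) = wallisRatio k ^ 3 *
      (((2 * k + 1) / (2 * k + 2)) ^ 3 * (-((k + 1 : ℕ) : ℝ) ^ 2 / (1 - 2 * ((k + 1 : ℕ) : ℝ)))
        - (-(k : ℝ) ^ 2 / (1 - 2 * (k : ℝ)))) := fun k => by
    have hk := one_sub_two_mul_ne_zero k
    push_cast
    rw [show 1 - 2 * ((k : ℝ) + 1) = -(2 * k + 1) by ring]
    generalize hv : 1 - 2 * (k : ℝ) = v at hk
    field_simp
    rw [← hv]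
    ring
  simp only [heq] at hc
  have hz := hasSum_wallisRatio_telescope (q := fun k => -(k : ℝ) ^ 2 / (1 - 2 * (k : ℝ)))
    (by simp) (fun k => by
      have hk0 := (Nat.cast_nonneg k : (0 : ℝ) ≤ k)
      rw [abs_div, abs_neg, abs_of_nonneg (sq_nonneg _),
        div_le_iff₀ (lt_of_lt_of_le one_pos (two_mul_sub_one_abs_ge_one k))]
      rcases Nat.eq_zero_or_pos k with rfl | hk
      · simp
      · have : (1 : ℝ) ≤ k := by exact_mod_cast hk
        rw [abs_of_nonpos (by linarith)]
        nlinarith) hc.summable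
  have := hc.unique hz
  rw [show S₀ - S₂ / 2 = S₁ by linarith]
  exact hs

/-- Here q(k) = k²/(k + 1), whose shift has its pole at k = -2; the relation is 27/8 S₃ - S₀/2 - 9/8
S₂ = 0. -/
theorem hasSum_wallisRatio_cube_div_add_two {S₀ S₂ : ℝ}
    (h0 : HasSum (fun k => wallisRatio k ^ 3) S₀)
    (h2 : HasSum (fun k : ℕ => wallisRatio k ^ 3 / (k + 1)) S₂) :
    HasSum (fun k : ℕ => wallisRatio k ^ 3 * ((k : ℝ) + 2)⁻¹) (4 / 27 * S₀ + S₂ / 3) := by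
  have hs := summable_wallisRatio_cube_div_add_two.hasSum
  set S₃ := ∑' k : ℕ, wallisRatio k ^ 3 * ((k : ℝ) + 2)⁻¹
  have hc := ((hs.mul_left (27 / 8)).sub (h0.mul_left (1 / 2))).sub (h2.mul_left (9 / 8))
  have heq : ∀ k : ℕ, 27 / 8 * (wallisRatio k ^ 3 * ((k : ℝ) + 2)⁻¹) -
      1 / 2 * wallisRatio k ^ 3 - 9 / 8 * (wallisRatio k ^ 3 / (k + 1)) = wallisRatio k ^ 3 *
      (((2 * k + 1) / (2 * k + 2)) ^ 3 * (((k + 1 : ℕ) : ℝ) ^ 2 / (((k + 1 : ℕ) : ℝ) + 1))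
        - ((k : ℝ) ^ 2 / ((k : ℝ) + 1))) := fun k => by
    push_cast
    rw [show (k : ℝ) + 1 + 1 = k + 2 by ring]
    field_simp
    ring
  simp only [heq] at hc
  have hz := hasSum_wallisRatio_telescope (q := fun k => (k : ℝ) ^ 2 / ((k : ℝ) + 1))
    (by simp) (fun k => by
      have hk0 := (Nat.cast_nonneg k : (0 : ℝ) ≤ k)
      rw [abs_of_nonneg (by positivity), div_le_iff₀ (by positivity)]
      nlinarith) hc.summable
  have := hc.unique hz
  rw [show 4 / 27 * S₀ + S₂ / 3 = S₃ by linarith]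
  exact hs

/-! ### The hypergeometric values. -/

theorem Gamma_neg_half_add_nat (k : ℕ) :
    Real.Gamma (-1 / 2 + k) = Real.Gamma ((k : ℝ) + 1 / 2) * (-2 * (1 - 2 * (k : ℝ))⁻¹) := by
  have hk := one_sub_two_mul_ne_zero k
  have h : (-1 / 2 + k : ℝ) ≠ 0 := fun h => hk (by linarith)
  have := Real.Gamma_add_one h
  rw [show (k : ℝ) + 1 / 2 = -1 / 2 + k + 1 by ring, this]
  field_simp
  ring

theorem hyp3F2Term_eq_wallisRatio (n k : ℕ) :
    hyp3F2Term (-1 / 2) (1 / 2) (3 / 2) 1 ((n : ℝ) + 1) 1 k =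
      -(√Real.pi ^ 3) * (wallisRatio k ^ 3 * ((1 + 2 * k) * (1 - 2 * (k : ℝ))⁻¹ *
        ((Nat.factorial k : ℝ) / (Nat.factorial (n + k) : ℝ)))) := by
  rw [hyp3F2Term, Gamma_neg_half_add_nat,
    show (3 / 2 + k : ℝ) = (k + 1 / 2 : ℝ) + 1 by ring, Real.Gamma_add_one (by positivity),
    show (1 / 2 + k : ℝ) = k + 1 / 2 by ring, show (1 + k : ℝ) = k + 1 by ring,
    show (n + 1 + k : ℝ) = ((n + k : ℕ) : ℝ) + 1 by push_cast; ring,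
    Real.Gamma_nat_eq_factorial, Real.Gamma_nat_eq_factorial, one_pow,
    Gamma_nat_add_half_eq_wallisRatio]
  have hk : (Nat.factorial k : ℝ) ≠ 0 := by positivity
  have hk : (Nat.factorial (n + k) : ℝ) ≠ 0 := by positivity
  field_simp
  ring

/-- The coefficients are the partial fractions of (1 + 2k)/((1 - 2k)(k + 1)). -/
theorem hasSum_hyp3F2Term_one_two {S₁ S₂ : ℝ}
    (h1 : HasSum (fun k : ℕ => wallisRatio k ^ 3 * (1 - 2 * (k : ℝ))⁻¹) S₁)
    (h2 : HasSum (fun k : ℕ => wallisRatio k ^ 3 / (k + 1)) S₂) :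
    HasSum (hyp3F2Term (-1 / 2) (1 / 2) (3 / 2) 1 2 1)
      (-(√Real.pi ^ 3) * (4 / 3 * S₁ - 1 / 3 * S₂)) := by
  convert! ((h1.mul_left (4 / 3)).sub (h2.mul_left (1 / 3))).mul_left (-(√Real.pi ^ 3)) using 1
  funext k
  have h := hyp3F2Term_eq_wallisRatio 1 k
  rw [show ((1 : ℕ) : ℝ) + 1 = 2 by norm_num] at h
  rw [h, add_comm 1 k, Nat.factorial_succ]
  have hk := one_sub_two_mul_ne_zero k
  have hk : (Nat.factorial k : ℝ) ≠ 0 := by positivity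
  push_cast
  field_simp
  ring

/-- The coefficients are the partial fractions of (1 + 2k)/((1 - 2k)(k + 1)(k + 2)). -/
theorem hasSum_hyp3F2Term_one_three {S₁ S₂ S₃ : ℝ}
    (h1 : HasSum (fun k : ℕ => wallisRatio k ^ 3 * (1 - 2 * (k : ℝ))⁻¹) S₁)
    (h2 : HasSum (fun k : ℕ => wallisRatio k ^ 3 / (k + 1)) S₂)
    (h3 : HasSum (fun k : ℕ => wallisRatio k ^ 3 * ((k : ℝ) + 2)⁻¹) S₃) :
    HasSum (hyp3F2Term (-1 / 2) (1 / 2) (3 / 2) 1 3 1)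
      (-(√Real.pi ^ 3) * (8 / 15 * S₁ - 1 / 3 * S₂ + 3 / 5 * S₃)) := by
  convert! (((h1.mul_left (8 / 15)).sub (h2.mul_left (1 / 3))).add
    (h3.mul_left (3 / 5))).mul_left (-(√Real.pi ^ 3)) using 1
  funext k
  have h := hyp3F2Term_eq_wallisRatio 2 k
  rw [show ((2 : ℕ) : ℝ) + 1 = 3 by norm_num] at h
  rw [h, add_comm 2 k, Nat.factorial_succ, Nat.factorial_succ]
  have hk := one_sub_two_mul_ne_zero k
  have hk : (Nat.factorial k : ℝ) ≠ 0 := by positivity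
  push_cast
  rw [show (k : ℝ) + 1 + 1 = k + 2 by ring]
  field_simp
  ring

theorem hyp3F2_prefactor (n : ℕ) :
    Real.Gamma 1 * Real.Gamma ((n : ℝ) + 1) /
      (Real.Gamma (-1 / 2) * Real.Gamma (1 / 2) * Real.Gamma (3 / 2)) * -(√Real.pi ^ 3) =
      (Nat.factorial n : ℝ) := by
  have h1 := Gamma_neg_half_add_nat 0
  have h2 : Real.Gamma (3 / 2) = 1 / 2 * √Real.pi := by
    rw [show (3 / 2 : ℝ) = 1 / 2 + 1 by norm_num, Real.Gamma_add_one (by norm_num),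
      Real.Gamma_one_half_eq]
  simp only [Nat.cast_zero, add_zero, zero_add, Real.Gamma_one_half_eq] at h1
  have hs : √Real.pi ≠ 0 := by positivity
  rw [h1, h2, Real.Gamma_one_half_eq, Real.Gamma_one, Real.Gamma_nat_eq_factorial]
  field_simp
  norm_num

theorem summable_hyp3F2Term_one_two : Summable (hyp3F2Term (-1 / 2) (1 / 2) (3 / 2) 1 2 1) :=
  (hasSum_hyp3F2Term_one_two summable_wallisRatio_cube_div_one_sub.hasSum
    hasSum_wallisRatio_cube_div_add_one).summable

theorem summable_hyp3F2Term_one_three : Summable (hyp3F2Term (-1 / 2) (1 / 2) (3 / 2) 1 3 1) :=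
  (hasSum_hyp3F2Term_one_three summable_wallisRatio_cube_div_one_sub.hasSum
    hasSum_wallisRatio_cube_div_add_one summable_wallisRatio_cube_div_add_two.hasSum).summable

theorem eight_mul_hyp3F2_sub_hyp3F2 :
    8 * hyp3F2 (-1 / 2) (1 / 2) (3 / 2) 1 2 1 - hyp3F2 (-1 / 2) (1 / 2) (3 / 2) 1 3 1 =
      (100 / 45 * coshIntegral (1 / 2) ^ 2 + 36 / 5 * coshIntegral (3 / 2) ^ 2) /
        (2 * Real.pi ^ 2) := by
  have h0 := hasSum_wallisRatio_cube
  have h2 := hasSum_wallisRatio_cube_div_add_one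
  have h1 := hasSum_wallisRatio_cube_div_one_sub h0 h2
  have h3 := hasSum_wallisRatio_cube_div_add_two h0 h2
  have p1 := hyp3F2_prefactor 1
  have p2 := hyp3F2_prefactor 2
  rw [show ((1 : ℕ) : ℝ) + 1 = 2 by norm_num] at p1
  rw [show ((2 : ℕ) : ℝ) + 1 = 3 by norm_num] at p2
  have e1 := fun x => congrArg (· * x) p1
  have e2 := fun x => congrArg (· * x) p2
  simp only [mul_assoc] at e1 e2
  rw [hyp3F2, hyp3F2, (hasSum_hyp3F2Term_one_two h1 h2).tsum_eq,
    (hasSum_hyp3F2Term_one_three h1 h2 h3).tsum_eq]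
  simp only [mul_assoc]
  rw [e1, e2]
  have : Real.pi ≠ 0 := Real.pi_ne_zero
  simp only [Nat.factorial]
  push_cast
  field_simp
  ring

/-! ### Spherical means through Gaussian integrals. -/

section Polar

variable {E : Type*} [NormedAddCommGroup E] [InnerProductSpace ℝ E] [FiniteDimensional ℝ E]
  [MeasurableSpace E] [BorelSpace E]

theorem lintegral_exp_neg_mul_norm_sq {c : ℝ} (hc : 0 < c) :
    ∫⁻ x : E, ENNReal.ofReal (Real.exp (-(c * ‖x‖ ^ 2))) =
      ENNReal.ofReal ((Real.pi / c) ^ ((Module.finrank ℝ E : ℝ) / 2)) := by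
  have h := GaussianFourier.integral_rexp_neg_mul_sq_norm (V := E) hc
  have hpos : 0 < (Real.pi / c) ^ ((Module.finrank ℝ E : ℝ) / 2) :=
    Real.rpow_pos_of_pos (div_pos Real.pi_pos hc) _
  simp only [neg_mul] at h
  rw [← h, ofReal_integral_eq_lintegral_ofReal]
  · by_contra hn
    rw [integral_undef hn] at h
    exact hpos.ne h
  · exact Eventually.of_forall fun x => (Real.exp_pos _).le

variable [Nontrivial E]

/-- Integration of a homogeneous function against a Gaussian weight, in polar coordinates. -/
theorem lintegral_homogeneous_mul_exp {f : E → ℝ} (hf : Measurable f) (hf0 : ∀ x, 0 ≤ f x)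
    {d : ℕ} (hd : ∀ r : ℝ, 0 < r → ∀ v, f (r • v) = r ^ d * f v) {c : ℝ} (hc : 0 < c) :
    ∫⁻ x, ENNReal.ofReal (f x * Real.exp (-(c * ‖x‖ ^ 2))) =
      (∫⁻ v : Metric.sphere (0 : E) 1, ENNReal.ofReal (f v) ∂(volume : Measure E).toSphere) *
        ENNReal.ofReal (Real.Gamma (((Module.finrank ℝ E : ℝ) + d) / 2) / 2 *
          c ^ (-(((Module.finrank ℝ E : ℝ) + d) / 2))) := by
  have hn : 0 < Module.finrank ℝ E := Module.finrank_pos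
  have hmp := (volume : Measure E).measurePreserving_homeomorphUnitSphereProd
  have hradial : ∫⁻ r : Ioi (0 : ℝ), ENNReal.ofReal ((r : ℝ) ^ d * Real.exp (-(c * (r : ℝ) ^ 2)))
      ∂(Measure.volumeIoiPow (Module.finrank ℝ E - 1)) =
      ENNReal.ofReal (Real.Gamma (((Module.finrank ℝ E : ℝ) + d) / 2) / 2 *
          c ^ (-(((Module.finrank ℝ E : ℝ) + d) / 2))) := by
    rw [Measure.volumeIoiPow, lintegral_withDensity_eq_lintegral_mul _ (by fun_prop) (by fun_prop)]
    simp only [Pi.mul_apply]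
    rw [lintegral_subtype_comap measurableSet_Ioi fun r : ℝ =>
      ENNReal.ofReal (r ^ (Module.finrank ℝ E - 1)) *
        ENNReal.ofReal (r ^ d * Real.exp (-(c * r ^ 2)))]
    have h := lintegral_pow_mul_exp_neg_mul_sq_Ioi (Module.finrank ℝ E - 1 + d) hc
    rw [show ((Module.finrank ℝ E - 1 + d : ℕ) : ℝ) + 1 = (Module.finrank ℝ E : ℝ) + d by
      push_cast [Nat.cast_sub hn]; ring] at h
    rw [← h]
    refine setLIntegral_congr_fun measurableSet_Ioi fun r (hr : 0 < r) => ?_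
    rw [← ENNReal.ofReal_mul (by positivity), pow_add]
    congr 1
    ring
  calc _ = ∫⁻ x : ({0}ᶜ : Set E), ENNReal.ofReal (f x * Real.exp (-(c * ‖(x : E)‖ ^ 2)))
          ∂((volume : Measure E).comap (↑)) := by
        rw [lintegral_subtype_comap (measurableSet_singleton _).compl
          fun x : E => ENNReal.ofReal (f x * Real.exp (-(c * ‖x‖ ^ 2))),
          restrict_compl_singleton]
    _ = ∫⁻ p : Metric.sphere (0 : E) 1 × Ioi (0 : ℝ), ENNReal.ofReal (f p.1) *
          ENNReal.ofReal ((p.2 : ℝ) ^ d * Real.exp (-(c * (p.2 : ℝ) ^ 2)))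
          ∂((volume : Measure E).toSphere.prod
            (Measure.volumeIoiPow (Module.finrank ℝ E - 1))) := by
        rw [← hmp.lintegral_comp_emb (Homeomorph.measurableEmbedding _)]
        refine lintegral_congr fun x => ?_
        have hx : 0 < ‖(x : E)‖ := norm_pos_iff.2 x.2
        rw [homeomorphUnitSphereProd_apply_fst_coe, homeomorphUnitSphereProd_apply_snd_coe,
          ← ENNReal.ofReal_mul (hf0 _)]
        congr 1
        have := hd ‖(x : E)‖ hx (‖(x : E)‖⁻¹ • (x : E))
        rw [smul_inv_smul₀ hx.ne'] at this
        rw [this]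
        ring
    _ = _ := by
        rw [lintegral_prod_mul (f := fun v : Metric.sphere (0 : E) 1 => ENNReal.ofReal (f v))
          (g := fun r : Ioi (0 : ℝ) =>
            ENNReal.ofReal ((r : ℝ) ^ d * Real.exp (-(c * (r : ℝ) ^ 2))))
          (by fun_prop) (by fun_prop), hradial]

theorem toSphere_univ_mul_Gamma :
    (volume : Measure E).toSphere univ *
      ENNReal.ofReal (Real.Gamma ((Module.finrank ℝ E : ℝ) / 2) / 2) =
      ENNReal.ofReal (Real.pi ^ ((Module.finrank ℝ E : ℝ) / 2)) := by
  have h := lintegral_homogeneous_mul_exp (E := E) (f := fun _ => 1) (d := 0) measurable_const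
    (fun _ => zero_le_one) (by simp) one_pos
  simp only [one_mul] at h
  have h2 := lintegral_exp_neg_mul_norm_sq (E := E) one_pos
  simp only [one_mul] at h2
  rw [h2] at h
  simpa using h.symm

theorem lintegral_norm_pow_mul_exp (d : ℕ) {c : ℝ} (hc : 0 < c) :
    ∫⁻ x : E, ENNReal.ofReal (‖x‖ ^ d * Real.exp (-(c * ‖x‖ ^ 2))) =
      ENNReal.ofReal (Real.pi ^ ((Module.finrank ℝ E : ℝ) / 2) *
        (Real.Gamma (((Module.finrank ℝ E : ℝ) + d) / 2) /
          Real.Gamma ((Module.finrank ℝ E : ℝ) / 2)) *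
        c ^ (-(((Module.finrank ℝ E : ℝ) + d) / 2))) := by
  have hn : (0 : ℝ) < Module.finrank ℝ E := Nat.cast_pos.2 Module.finrank_pos
  have h1 : 0 < Real.Gamma ((Module.finrank ℝ E : ℝ) / 2) :=
    Real.Gamma_pos_of_pos (by positivity)
  have h2 : 0 < Real.Gamma (((Module.finrank ℝ E : ℝ) + d) / 2) :=
    Real.Gamma_pos_of_pos (by positivity)
  rw [lintegral_homogeneous_mul_exp (d := d) (by fun_prop) (fun _ => by positivity)
    (fun r hr v => by rw [norm_smul, Real.norm_of_nonneg hr.le, mul_pow]) hc]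
  have hone : ∀ v : Metric.sphere (0 : E) 1, ENNReal.ofReal (‖(v : E)‖ ^ d) = 1 := fun v => by
    simp
  simp only [hone, lintegral_one]
  have key := toSphere_univ_mul_Gamma (E := E)
  -- The factor Γ(n/2)/2 is split off so that the total mass of the sphere can be eliminated.
  rw [show Real.Gamma (((Module.finrank ℝ E : ℝ) + d) / 2) / 2 *
      c ^ (-(((Module.finrank ℝ E : ℝ) + d) / 2)) =
      Real.Gamma ((Module.finrank ℝ E : ℝ) / 2) / 2 *
        (Real.Gamma (((Module.finrank ℝ E : ℝ) + d) / 2) /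
          Real.Gamma ((Module.finrank ℝ E : ℝ) / 2) *
        c ^ (-(((Module.finrank ℝ E : ℝ) + d) / 2))) by field_simp,
    ENNReal.ofReal_mul (by positivity), ← mul_assoc, key, ← ENNReal.ofReal_mul (by positivity)]
  congr 1
  ring

/-- The spherical mean of a homogeneous function in terms of its Gaussian integral. -/
theorem integral_sphereUniform_eq {f : E → ℝ} (hf : Measurable f) (hf0 : ∀ x, 0 ≤ f x)
    {d : ℕ} (hd : ∀ r : ℝ, 0 < r → ∀ v, f (r • v) = r ^ d * f v) {G : ℝ} (hG : 0 ≤ G)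
    (h : ∫⁻ x, ENNReal.ofReal (f x * Real.exp (-‖x‖ ^ 2)) = ENNReal.ofReal G) :
    ∫ v : Metric.sphere (0 : E) 1, f v ∂(sphereUniform E) =
      Real.Gamma ((Module.finrank ℝ E : ℝ) / 2) /
        Real.Gamma (((Module.finrank ℝ E : ℝ) + d) / 2) /
        Real.pi ^ ((Module.finrank ℝ E : ℝ) / 2) * G := by
  have hn : (0 : ℝ) < Module.finrank ℝ E := Nat.cast_pos.2 Module.finrank_pos
  have h1 : 0 < Real.Gamma ((Module.finrank ℝ E : ℝ) / 2) :=
    Real.Gamma_pos_of_pos (by positivity)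
  have h2 : 0 < Real.Gamma (((Module.finrank ℝ E : ℝ) + d) / 2) :=
    Real.Gamma_pos_of_pos (by positivity)
  have hpi : 0 < Real.pi ^ ((Module.finrank ℝ E : ℝ) / 2) := Real.rpow_pos_of_pos Real.pi_pos _
  have e := lintegral_homogeneous_mul_exp hf hf0 hd one_pos
  simp only [one_mul, Real.one_rpow, mul_one] at e
  rw [h] at e
  have e1 := congrArg ENNReal.toReal e
  have e2 := congrArg ENNReal.toReal (toSphere_univ_mul_Gamma (E := E))
  rw [ENNReal.toReal_mul, ENNReal.toReal_ofReal hG, ENNReal.toReal_ofReal (by positivity)] at e1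
  rw [ENNReal.toReal_mul, ENNReal.toReal_ofReal hpi.le, ENNReal.toReal_ofReal (by positivity)] at e2
  rw [sphereUniform, integral_smul_measure, integral_eq_lintegral_of_nonneg_ae
    (f := fun v : Metric.sphere (0 : E) 1 => f v) (Eventually.of_forall fun v => hf0 v)
    (hf.comp measurable_subtype_coe).aestronglyMeasurable, ENNReal.toReal_inv, smul_eq_mul, e1, ← e2]
  have hs : ((volume : Measure E).toSphere univ).toReal ≠ 0 := by
    intro h0
    rw [h0, zero_mul] at e2
    exact hpi.ne e2
  field_simp

end Polar

/-! ### The spherical means that enter the moments. -/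

theorem Gamma_five_half : Real.Gamma (5 / 2) = 3 / 4 * √Real.pi := by
  rw [show (5 / 2 : ℝ) = 1 / 2 + 1 + 1 by norm_num, Real.Gamma_add_one (by norm_num),
    Real.Gamma_add_one (by norm_num), Real.Gamma_one_half_eq]
  ring

theorem lintegral_euclideanSpace_succAbove {n : ℕ} (i : Fin (n + 1))
    {F : ℝ → EuclideanSpace ℝ (Fin n) → ℝ≥0∞} (hF : Measurable (Function.uncurry F)) :
    ∫⁻ x : EuclideanSpace ℝ (Fin (n + 1)),
        F (x i) (WithLp.toLp 2 fun j => x (i.succAbove j)) =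
      ∫⁻ t : ℝ, ∫⁻ y : EuclideanSpace ℝ (Fin n), F t y := by
  have h1 := (PiLp.volume_preserving_ofLp (Fin (n + 1))).lintegral_comp_emb
    (MeasurableEquiv.toLp 2 (Fin (n + 1) → ℝ)).symm.measurableEmbedding
    fun x : Fin (n + 1) → ℝ => F (x i) (WithLp.toLp 2 fun j => x (i.succAbove j))
  have h2 := (volume_preserving_piFinSuccAbove (fun _ : Fin (n + 1) => ℝ) i).lintegral_comp_emb
    (MeasurableEquiv.measurableEmbedding _)
    fun p : ℝ × (Fin n → ℝ) => F p.1 (WithLp.toLp 2 p.2)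
  have hm : Measurable fun p : ℝ × (Fin n → ℝ) => F p.1 (WithLp.toLp 2 p.2) :=
    hF.comp (measurable_fst.prodMk
      ((MeasurableEquiv.toLp 2 (Fin n → ℝ)).measurable.comp measurable_snd))
  refine h1.trans (h2.trans ?_)
  rw [Measure.volume_eq_prod, lintegral_prod _ hm.aemeasurable]
  refine lintegral_congr fun t => ?_
  exact (PiLp.volume_preserving_toLp (Fin n)).lintegral_comp_emb
    (MeasurableEquiv.toLp 2 (Fin n → ℝ)).measurableEmbedding (F t)

theorem norm_sq_eq_sq_add_norm_sq_succAbove {n : ℕ} (i : Fin (n + 1))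
    (x : EuclideanSpace ℝ (Fin (n + 1))) :
    ‖x‖ ^ 2 = x i ^ 2 + ‖WithLp.toLp 2 fun j => x (i.succAbove j)‖ ^ 2 := by
  rw [EuclideanSpace.real_norm_sq_eq, EuclideanSpace.real_norm_sq_eq, Fin.sum_univ_succAbove _ i]

theorem integral_abs_inner_sphereUniform {E : Type*} [NormedAddCommGroup E]
    [InnerProductSpace ℝ E] [FiniteDimensional ℝ E] [MeasurableSpace E] [BorelSpace E]
    (hE : Module.finrank ℝ E = 4) (p : E) :
    ∫ v : Metric.sphere (0 : E) 1, |inner ℝ (v : E) p| ∂(sphereUniform E) =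
      4 / (3 * Real.pi) * ‖p‖ := by
  have : Nontrivial E := Module.nontrivial_of_finrank_pos (R := ℝ) (by omega)
  rcases eq_or_ne p 0 with rfl | hp
  · simp
  have hp' : 0 < ‖p‖ := norm_pos_iff.2 hp
  -- In an orthonormal basis starting with p/‖p‖ the integrand depends on one coordinate, and the
  -- other three give a plain Gaussian.
  obtain ⟨b, hb⟩ := Orthonormal.exists_orthonormalBasis_extension_of_card_eq (𝕜 := ℝ)
    (ι := Fin 4) (by simpa using hE) (v := fun _ => ‖p‖⁻¹ • p) (s := {0}) (by
      rw [orthonormal_iff_ite]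
      rintro ⟨i, rfl⟩ ⟨j, rfl⟩
      simp [norm_smul, hp'.ne'])
  have hb0 : p = ‖p‖ • b 0 := by
    rw [hb 0 rfl, smul_inv_smul₀ hp'.ne']
  have hgauss : ∫⁻ x : E, ENNReal.ofReal (|inner ℝ x p| * Real.exp (-‖x‖ ^ 2)) =
      ENNReal.ofReal (‖p‖ * Real.pi ^ (3 / 2 : ℝ)) := by
    have hF : Measurable (Function.uncurry fun (t : ℝ) (y : EuclideanSpace ℝ (Fin 3)) =>
        ENNReal.ofReal (‖p‖ * (|t| * Real.exp (-(1 * |t| ^ 2)))) *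
          ENNReal.ofReal (Real.exp (-(1 * ‖y‖ ^ 2)))) := by
      simp only [Function.uncurry_def]
      fun_prop
    have h := lintegral_euclideanSpace_succAbove (n := 3) 0 hF
    rw [← b.measurePreserving_repr.lintegral_comp_emb
      b.measurableEquiv.measurableEmbedding] at h
    calc _ = _ := by
          refine lintegral_congr fun x => ?_
          have hx : inner ℝ x p = ‖p‖ * b.repr x 0 := by
            conv_lhs => rw [hb0]
            rw [inner_smul_right, b.repr_apply_apply, real_inner_comm]
          rw [← ENNReal.ofReal_mul (by positivity), mul_assoc, mul_assoc, ← Real.exp_add, hx,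
            abs_mul, abs_of_pos hp', mul_assoc, ← b.repr.norm_map x,
            norm_sq_eq_sq_add_norm_sq_succAbove 0 (b.repr x), sq_abs]
          congr 4
          ring
      _ = _ := h
      _ = _ := by
          simp_rw [lintegral_const_mul' _ _ ENNReal.ofReal_ne_top,
            lintegral_exp_neg_mul_norm_sq one_pos, ENNReal.ofReal_mul hp'.le]
          rw [lintegral_mul_const' _ _ ENNReal.ofReal_ne_top,
            lintegral_const_mul' _ _ ENNReal.ofReal_ne_top]
          have h1 := lintegral_norm_pow_mul_exp (E := ℝ) 1 one_pos
          simp only [Real.norm_eq_abs, pow_one] at h1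
          rw [h1, Module.finrank_self]
          simp only [Nat.cast_one, Real.one_rpow, mul_one, div_one]
          rw [show ((1 : ℝ) + 1) / 2 = 1 by norm_num, Real.Gamma_one, Real.Gamma_one_half_eq,
            ← Real.sqrt_eq_rpow, mul_one_div_cancel (by positivity)]
          simp
  rw [integral_sphereUniform_eq (f := fun x => |inner ℝ x p|) (d := 1) (by fun_prop)
    (fun _ => abs_nonneg _) (fun r hr v => by
      rw [real_inner_smul_left, abs_mul, abs_of_pos hr, pow_one]) (by positivity) hgauss, hE]
  have h2 := Gamma_five_half
  have h3 : Real.pi ^ (3 / 2 : ℝ) = Real.pi * √Real.pi := by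
    rw [Real.sqrt_eq_rpow, ← Real.rpow_one_add' Real.pi_pos.le (by norm_num)]
    norm_num
  have h4 : Real.Gamma 2 = 1 := by simp
  have hs : √Real.pi ≠ 0 := by positivity
  push_cast
  rw [show ((4 : ℝ) + 1) / 2 = 5 / 2 by norm_num, show (4 : ℝ) / 2 = 2 by norm_num, h2, h3, h4,
    Real.rpow_two]
  field_simp

theorem norm_sq_sub_sq_nonneg {n : ℕ} (i : Fin n) (x : EuclideanSpace ℝ (Fin n)) :
    0 ≤ ‖x‖ ^ 2 - x i ^ 2 := by
  rw [EuclideanSpace.real_norm_sq_eq, sub_nonneg]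
  exact Finset.single_le_sum (f := fun j => x j ^ 2) (fun j _ => sq_nonneg _) (Finset.mem_univ i)

theorem sqrt_norm_sq_sub_sq_smul {n : ℕ} (i : Fin n) {r : ℝ} (hr : 0 < r)
    (x : EuclideanSpace ℝ (Fin n)) :
    √(‖r • x‖ ^ 2 - (r • x) i ^ 2) = r * √(‖x‖ ^ 2 - x i ^ 2) := by
  rw [norm_smul, Real.norm_of_nonneg hr.le, PiLp.smul_apply, smul_eq_mul,
    show (r * ‖x‖) ^ 2 - (r * x i) ^ 2 = r ^ 2 * (‖x‖ ^ 2 - x i ^ 2) by ring,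
    Real.sqrt_mul (sq_nonneg r), Real.sqrt_sq hr.le]

theorem integral_sqrt_one_sub_sq_sphereUniform (i : Fin 5) :
    ∫ u : Metric.sphere (0 : EuclideanSpace ℝ (Fin 5)) 1,
        √(1 - (u : EuclideanSpace ℝ (Fin 5)) i ^ 2)
          ∂(sphereUniform (EuclideanSpace ℝ (Fin 5))) = 9 * Real.pi / 32 := by
  have hgauss : ∫⁻ x : EuclideanSpace ℝ (Fin 5),
      ENNReal.ofReal (√(‖x‖ ^ 2 - x i ^ 2) * Real.exp (-‖x‖ ^ 2)) =
      ENNReal.ofReal (√Real.pi * (Real.pi ^ 2 * Real.Gamma (5 / 2))) := by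
    have hF : Measurable (Function.uncurry fun (t : ℝ) (y : EuclideanSpace ℝ (Fin 4)) =>
        ENNReal.ofReal (Real.exp (-(1 * ‖t‖ ^ 2))) *
          ENNReal.ofReal (‖y‖ ^ 1 * Real.exp (-(1 * ‖y‖ ^ 2)))) := by
      simp only [Function.uncurry_def]
      fun_prop
    have h := lintegral_euclideanSpace_succAbove (n := 4) i hF
    calc _ = _ := by
          refine lintegral_congr fun x => ?_
          rw [← ENNReal.ofReal_mul (by positivity), norm_sq_eq_sq_add_norm_sq_succAbove i x,
            add_sub_cancel_left, Real.sqrt_sq (norm_nonneg _), mul_left_comm, ← Real.exp_add,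
            pow_one, Real.norm_eq_abs, sq_abs]
          congr 3
          ring
      _ = _ := h
      _ = _ := by
          simp_rw [lintegral_const_mul' _ _ ENNReal.ofReal_ne_top,
            lintegral_norm_pow_mul_exp 1 one_pos]
          rw [lintegral_mul_const' _ _ ENNReal.ofReal_ne_top,
            lintegral_exp_neg_mul_norm_sq one_pos, ← ENNReal.ofReal_mul (by positivity)]
          simp only [Module.finrank_self, finrank_euclideanSpace, Fintype.card_fin]
          have h4 : Real.Gamma 2 = 1 := by simp
          push_cast
          rw [show ((4 : ℝ) + 1) / 2 = 5 / 2 by norm_num, show (4 : ℝ) / 2 = 2 by norm_num, h4,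
            ← Real.sqrt_eq_rpow]
          simp
  have h := integral_sphereUniform_eq (f := fun x : EuclideanSpace ℝ (Fin 5) =>
    √(‖x‖ ^ 2 - x i ^ 2)) (d := 1) (by fun_prop) (fun _ => Real.sqrt_nonneg _)
    (fun r hr v => by rw [sqrt_norm_sq_sub_sq_smul i hr, pow_one])
    (mul_nonneg (by positivity) (mul_nonneg (by positivity)
      (Real.Gamma_pos_of_pos (by norm_num)).le)) hgauss
  simp only [norm_eq_of_mem_sphere, one_pow] at h
  rw [h, finrank_euclideanSpace, Fintype.card_fin]
  have h2 := Gamma_five_half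
  have h3 : Real.pi ^ (5 / 2 : ℝ) = Real.pi ^ 2 * √Real.pi := by
    rw [Real.sqrt_eq_rpow, ← Real.rpow_two, ← Real.rpow_add Real.pi_pos]
    norm_num
  have h4 : Real.Gamma 3 = 2 := by simp
  have hs : 0 < √Real.pi := by positivity
  have hsq : √Real.pi ^ 2 = Real.pi := Real.sq_sqrt Real.pi_pos.le
  push_cast
  rw [show ((5 : ℝ) + 1) / 2 = 3 by norm_num, h2, h3, h4]
  field_simp
  rw [hsq]
  ring

/-- After p = sinh a, q = sinh b the numerator is (cosh a cosh b)², a quarter of (cosh (a+b) + cosh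
(a-b))². Expanding the square gives three separated products, and the recursion
`coshIntegral_add_two` lowers the exponents 5/2 and 7/2 to 1/2 and 3/2. -/
theorem lintegral_lintegral_sqrt_mul_sqrt_mul_rpow :
    ∫⁻ p : ℝ, ∫⁻ q : ℝ, ENNReal.ofReal (√(1 + p ^ 2) * √(1 + q ^ 2) *
        (1 + p ^ 2 + q ^ 2) ^ (-(7 / 2 : ℝ))) =
      ENNReal.ofReal
        ((3 / 5 * coshIntegral (3 / 2) ^ 2 + 1 / 9 * coshIntegral (1 / 2) ^ 2) / 4) := by
  have hmeas : Measurable (Function.uncurry fun p q : ℝ => (1 + p ^ 2) * (1 + q ^ 2) *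
      (1 + p ^ 2 + q ^ 2) ^ (-(7 / 2 : ℝ))) := by
    have h : Continuous fun p : ℝ × ℝ => 1 + p.1 ^ 2 + p.2 ^ 2 := by fun_prop
    exact Measurable.mul (by fun_prop) (h.measurable.pow_const _)
  have h1 : ∀ p q : ℝ, √(1 + p ^ 2) * √(1 + q ^ 2) * (1 + p ^ 2 + q ^ 2) ^ (-(7 / 2 : ℝ)) =
      (1 + p ^ 2) * (1 + q ^ 2) * (1 + p ^ 2 + q ^ 2) ^ (-(7 / 2 : ℝ)) /
        (√(1 + p ^ 2) * √(1 + q ^ 2)) := fun p q => by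
    have hp : 0 < 1 + p ^ 2 := by positivity
    have hq : 0 < 1 + q ^ 2 := by positivity
    have := Real.sqrt_pos.2 hp
    have := Real.sqrt_pos.2 hq
    field_simp
    rw [Real.sq_sqrt hp.le, Real.sq_sqrt hq.le]
  simp only [h1]
  rw [lintegral_lintegral_hyperbolic hmeas]
  have h2 : ∀ a b : ℝ, (1 + Real.sinh a ^ 2) * (1 + Real.sinh b ^ 2) *
      (1 + Real.sinh a ^ 2 + Real.sinh b ^ 2) ^ (-(7 / 2 : ℝ)) =
      1 / 4 * (Real.cosh (a + b) ^ (-(3 / 2) : ℝ) * Real.cosh (a - b) ^ (-(7 / 2) : ℝ)) +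
      1 / 2 * (Real.cosh (a + b) ^ (-(5 / 2) : ℝ) * Real.cosh (a - b) ^ (-(5 / 2) : ℝ)) +
      1 / 4 * (Real.cosh (a + b) ^ (-(7 / 2) : ℝ) * Real.cosh (a - b) ^ (-(3 / 2) : ℝ)) :=
    fun a b => by
      have hs := Real.cosh_pos (a + b)
      have ht := Real.cosh_pos (a - b)
      have e5 : (-(5 / 2) : ℝ) = -(7 / 2) + 1 := by norm_num
      have e3 : (-(3 / 2) : ℝ) = -(7 / 2) + 1 + 1 := by norm_num
      rw [one_add_sinh_sq_add_sinh_sq, cosh_mul_cosh_rpow, ← Real.cosh_sq', ← Real.cosh_sq',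
        ← mul_pow, cosh_mul_cosh_eq, e3, e5]
      simp only [Real.rpow_add_one hs.ne', Real.rpow_add_one ht.ne']
      ring
  have hm : ∀ α β : ℝ, Measurable fun p : ℝ × ℝ => ENNReal.ofReal
      (Real.cosh (p.1 + p.2) ^ (-α) * Real.cosh (p.1 - p.2) ^ (-β)) := fun α β => by
    have h3 : Continuous fun p : ℝ × ℝ => Real.cosh (p.1 + p.2) := by fun_prop
    have h4 : Continuous fun p : ℝ × ℝ => Real.cosh (p.1 - p.2) := by fun_prop
    exact ((h3.measurable.pow_const _).mul (h4.measurable.pow_const _)).ennreal_ofReal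
  have hma : ∀ α β a : ℝ, Measurable fun b : ℝ => ENNReal.ofReal
      (Real.cosh (a + b) ^ (-α) * Real.cosh (a - b) ^ (-β)) := fun α β a =>
    (hm α β).comp (f := fun b : ℝ => (a, b)) (by fun_prop)
  have hi : ∀ α β : ℝ, Measurable fun a : ℝ => ∫⁻ b : ℝ, ENNReal.ofReal
      (Real.cosh (a + b) ^ (-α) * Real.cosh (a - b) ^ (-β)) := fun α β =>
    (hm α β).lintegral_prod_right
  have hnn : ∀ s t α β : ℝ, 0 ≤ Real.cosh s ^ α * Real.cosh t ^ β := fun s t α β =>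
    mul_nonneg (Real.rpow_nonneg (Real.cosh_pos _).le _) (Real.rpow_nonneg (Real.cosh_pos _).le _)
  have h3 : ∀ a b : ℝ, ENNReal.ofReal ((1 + Real.sinh a ^ 2) * (1 + Real.sinh b ^ 2) *
      (1 + Real.sinh a ^ 2 + Real.sinh b ^ 2) ^ (-(7 / 2 : ℝ))) =
      ENNReal.ofReal (1 / 4) * ENNReal.ofReal (Real.cosh (a + b) ^ (-(3 / 2) : ℝ) *
        Real.cosh (a - b) ^ (-(7 / 2) : ℝ)) +
      ENNReal.ofReal (1 / 2) * ENNReal.ofReal (Real.cosh (a + b) ^ (-(5 / 2) : ℝ) *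
        Real.cosh (a - b) ^ (-(5 / 2) : ℝ)) +
      ENNReal.ofReal (1 / 4) * ENNReal.ofReal (Real.cosh (a + b) ^ (-(7 / 2) : ℝ) *
        Real.cosh (a - b) ^ (-(3 / 2) : ℝ)) := fun a b => by
    have n1 := hnn (a + b) (a - b) (-(3 / 2)) (-(7 / 2))
    have n2 := hnn (a + b) (a - b) (-(5 / 2)) (-(5 / 2))
    have n3 := hnn (a + b) (a - b) (-(7 / 2)) (-(3 / 2))
    rw [h2, ENNReal.ofReal_add (by positivity) (by positivity),
      ENNReal.ofReal_add (by positivity) (by positivity), ENNReal.ofReal_mul (by norm_num : (0 : ℝ) ≤ 1 / 4),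
      ENNReal.ofReal_mul (by norm_num : (0 : ℝ) ≤ 1 / 2),
      ENNReal.ofReal_mul (by norm_num : (0 : ℝ) ≤ 1 / 4)]
  simp only [h3]
  have h4 : ∀ {f g h : ℝ → ℝ≥0∞} {x y z : ℝ}, Measurable f → Measurable g →
      ∫⁻ b, (ENNReal.ofReal x * f b + ENNReal.ofReal y * g b + ENNReal.ofReal z * h b) =
        ENNReal.ofReal x * (∫⁻ b, f b) + ENNReal.ofReal y * (∫⁻ b, g b) +
          ENNReal.ofReal z * ∫⁻ b, h b := fun {f g h x y z} hf hg => by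
    have hm : Measurable fun b => ENNReal.ofReal x * f b + ENNReal.ofReal y * g b := by fun_prop
    rw [lintegral_add_left hm, lintegral_add_left (by fun_prop)]
    simp_rw [lintegral_const_mul' _ _ ENNReal.ofReal_ne_top]
  simp_rw [h4 (hma _ _ _) (hma _ _ _)]
  rw [h4 (hi _ _) (hi _ _)]
  have c1 := coshIntegral_pos (a := 1 / 2) (by norm_num)
  have c3 := coshIntegral_pos (a := 3 / 2) (by norm_num)
  have c5 := coshIntegral_pos (a := 5 / 2) (by norm_num)
  have c7 := coshIntegral_pos (a := 7 / 2) (by norm_num)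
  have r5 := coshIntegral_add_two (a := 1 / 2) (by norm_num)
  have r7 := coshIntegral_add_two (a := 3 / 2) (by norm_num)
  rw [show (1 / 2 + 2 : ℝ) = 5 / 2 by norm_num] at r5
  rw [show (3 / 2 + 2 : ℝ) = 7 / 2 by norm_num] at r7
  rw [lintegral_lintegral_cosh_rpow (by norm_num) (by norm_num),
    lintegral_lintegral_cosh_rpow (by norm_num) (by norm_num),
    lintegral_lintegral_cosh_rpow (by norm_num) (by norm_num),
    ← ENNReal.ofReal_mul (by norm_num), ← ENNReal.ofReal_mul (by norm_num),
    ← ENNReal.ofReal_mul (by norm_num), ← ENNReal.ofReal_add (by positivity) (by positivity),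
    ← ENNReal.ofReal_add (by positivity) (by positivity), r5, r7]
  congr 1
  ring

theorem lintegral_sqrt_add_sq_mul {ρ : ℝ} (hρ : 0 < ρ) :
    ∫⁻ t : ℝ, ENNReal.ofReal (√(t ^ 2 + ρ ^ 2) * Real.exp (-t ^ 2)) =
      ∫⁻ t : ℝ, ENNReal.ofReal (ρ ^ 2 * (√(1 + t ^ 2) * Real.exp (-(ρ ^ 2 * t ^ 2)))) := by
  have h := lintegral_comp_mul_left_real hρ.ne'
    (f := fun t => ENNReal.ofReal (√(t ^ 2 + ρ ^ 2) * Real.exp (-t ^ 2))) (by fun_prop)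
  have hinv : ENNReal.ofReal ρ * ENNReal.ofReal |ρ⁻¹| = 1 := by
    rw [← ENNReal.ofReal_mul hρ.le, abs_of_pos (by positivity), mul_inv_cancel₀ hρ.ne',
      ENNReal.ofReal_one]
  rw [← one_mul (∫⁻ t : ℝ, ENNReal.ofReal (√(t ^ 2 + ρ ^ 2) * _)), ← hinv, mul_assoc, ← h,
    ← lintegral_const_mul' _ _ ENNReal.ofReal_ne_top]
  refine lintegral_congr fun t => ?_
  rw [← ENNReal.ofReal_mul hρ.le, show (ρ * t) ^ 2 + ρ ^ 2 = ρ ^ 2 * (1 + t ^ 2) by ring,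
    Real.sqrt_mul (sq_nonneg _), Real.sqrt_sq hρ.le]
  congr 1
  rw [mul_pow]
  ring

/-- Rescaling p and q by ‖z‖ makes the exponent -(1 + p² + q²)‖z‖² and pulls out ‖z‖⁴. Integrating
over z first then yields the power -(3 + 4)/2 of 1 + p² + q². -/
theorem lintegral_gaussian_sqrt_mul_sqrt :
    ∫⁻ p : ℝ, ∫⁻ q : ℝ, ∫⁻ z : EuclideanSpace ℝ (Fin 3),
        ENNReal.ofReal (√(p ^ 2 + ‖z‖ ^ 2) * Real.exp (-p ^ 2)) *
          (ENNReal.ofReal (√(q ^ 2 + ‖z‖ ^ 2) * Real.exp (-q ^ 2)) *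
            ENNReal.ofReal (Real.exp (-‖z‖ ^ 2))) =
      ENNReal.ofReal (Real.pi ^ (3 / 2 : ℝ) * (Real.Gamma (7 / 2) / Real.Gamma (3 / 2)) *
        ((3 / 5 * coshIntegral (3 / 2) ^ 2 + 1 / 9 * coshIntegral (1 / 2) ^ 2) / 4)) := by
  have swap : ∀ {Φ : ℝ → ℝ → EuclideanSpace ℝ (Fin 3) → ℝ≥0∞},
      (Measurable fun x : (ℝ × ℝ) × EuclideanSpace ℝ (Fin 3) => Φ x.1.1 x.1.2 x.2) →
      ∫⁻ p : ℝ, ∫⁻ q : ℝ, ∫⁻ z, Φ p q z = ∫⁻ z, ∫⁻ p : ℝ, ∫⁻ q : ℝ, Φ p q z := by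
    intro Φ hΦ
    calc _ = ∫⁻ p : ℝ, ∫⁻ z, ∫⁻ q : ℝ, Φ p q z := by
          refine lintegral_congr fun p => lintegral_lintegral_swap ?_
          exact (hΦ.comp (f := fun x : ℝ × EuclideanSpace ℝ (Fin 3) => ((p, x.1), x.2))
            (by fun_prop)).aemeasurable
      _ = _ := by
          refine lintegral_lintegral_swap (Measurable.aemeasurable ?_)
          exact (hΦ.comp (f := fun x : (ℝ × EuclideanSpace ℝ (Fin 3)) × ℝ =>
            ((x.1.1, x.2), x.1.2)) (by fun_prop)).lintegral_prod_right'
  have hpi : 0 < Real.pi ^ (3 / 2 : ℝ) := Real.rpow_pos_of_pos Real.pi_pos _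
  have hg : 0 < Real.Gamma (7 / 2) / Real.Gamma (3 / 2) :=
    div_pos (Real.Gamma_pos_of_pos (by norm_num)) (Real.Gamma_pos_of_pos (by norm_num))
  rw [swap (by fun_prop)]
  calc _ = ∫⁻ z : EuclideanSpace ℝ (Fin 3), ∫⁻ p : ℝ, ∫⁻ q : ℝ,
        ENNReal.ofReal (√(1 + p ^ 2) * √(1 + q ^ 2)) *
          ENNReal.ofReal (‖z‖ ^ 4 * Real.exp (-((1 + p ^ 2 + q ^ 2) * ‖z‖ ^ 2))) := by
        -- The rescaling needs ‖z‖ > 0, so the null set z = 0 is discarded.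
        have hne : ∀ᵐ z : EuclideanSpace ℝ (Fin 3), z ≠ 0 := by
          simp [ae_iff]
        refine lintegral_congr_ae ?_
        filter_upwards [hne] with z hz
        have hz' : 0 < ‖z‖ := norm_pos_iff.2 hz
        simp_rw [lintegral_const_mul' _ _ ENNReal.ofReal_ne_top,
          lintegral_mul_const' _ _ ENNReal.ofReal_ne_top]
        rw [lintegral_mul_const'' _ (by fun_prop), lintegral_sqrt_add_sq_mul hz',
          ← lintegral_mul_const _ (by fun_prop)]
        refine lintegral_congr fun p => ?_
        rw [← lintegral_mul_const _ (by fun_prop), ← lintegral_const_mul _ (by fun_prop)]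
        refine lintegral_congr fun q => ?_
        rw [← ENNReal.ofReal_mul (by positivity), ← ENNReal.ofReal_mul (by positivity),
          ← ENNReal.ofReal_mul (by positivity),
          show -((1 + p ^ 2 + q ^ 2) * ‖z‖ ^ 2) =
            -(‖z‖ ^ 2 * p ^ 2) + -(‖z‖ ^ 2 * q ^ 2) + -‖z‖ ^ 2 by ring,
          Real.exp_add, Real.exp_add]
        congr 1
        ring
    _ = ∫⁻ p : ℝ, ∫⁻ q : ℝ, ∫⁻ z : EuclideanSpace ℝ (Fin 3),
        ENNReal.ofReal (√(1 + p ^ 2) * √(1 + q ^ 2)) *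
          ENNReal.ofReal (‖z‖ ^ 4 * Real.exp (-((1 + p ^ 2 + q ^ 2) * ‖z‖ ^ 2))) :=
        (swap (by fun_prop)).symm
    _ = ∫⁻ p : ℝ, ∫⁻ q : ℝ, ENNReal.ofReal (Real.pi ^ (3 / 2 : ℝ) *
        (Real.Gamma (7 / 2) / Real.Gamma (3 / 2))) * ENNReal.ofReal (√(1 + p ^ 2) *
          √(1 + q ^ 2) * (1 + p ^ 2 + q ^ 2) ^ (-(7 / 2 : ℝ))) := by
        refine lintegral_congr fun p => lintegral_congr fun q => ?_
        rw [lintegral_const_mul' _ _ ENNReal.ofReal_ne_top,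
          lintegral_norm_pow_mul_exp 4 (by positivity), finrank_euclideanSpace, Fintype.card_fin,
          ← ENNReal.ofReal_mul (by positivity), ← ENNReal.ofReal_mul (by positivity)]
        push_cast
        rw [show ((3 : ℝ) + 4) / 2 = 7 / 2 by norm_num]
        congr 1
        ring
    _ = _ := by
        simp_rw [lintegral_const_mul' _ _ ENNReal.ofReal_ne_top]
        rw [lintegral_lintegral_sqrt_mul_sqrt_mul_rpow, ← ENNReal.ofReal_mul (by positivity)]

theorem integral_sqrt_mul_sqrt_sphereUniform {i j : Fin 5} (hij : i ≠ j) :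
    ∫ u : Metric.sphere (0 : EuclideanSpace ℝ (Fin 5)) 1,
        √(1 - (u : EuclideanSpace ℝ (Fin 5)) i ^ 2) * √(1 - (u : EuclideanSpace ℝ (Fin 5)) j ^ 2)
          ∂(sphereUniform (EuclideanSpace ℝ (Fin 5))) =
      (9 / 40 * coshIntegral (3 / 2) ^ 2 + 1 / 24 * coshIntegral (1 / 2) ^ 2) / Real.pi := by
  -- Coordinate j becomes coordinate k of the four that remain once i is split off; splitting off k
  -- as well leaves z in dimension 3.
  obtain ⟨k, rfl⟩ := Fin.exists_succAbove_eq hij.symm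
  have hgauss : ∫⁻ x : EuclideanSpace ℝ (Fin 5), ENNReal.ofReal
      (√(‖x‖ ^ 2 - x i ^ 2) * √(‖x‖ ^ 2 - x (i.succAbove k) ^ 2) * Real.exp (-‖x‖ ^ 2)) =
      ENNReal.ofReal (Real.pi ^ (3 / 2 : ℝ) * (Real.Gamma (7 / 2) / Real.Gamma (3 / 2)) *
        ((3 / 5 * coshIntegral (3 / 2) ^ 2 + 1 / 9 * coshIntegral (1 / 2) ^ 2) / 4)) := by
    rw [← lintegral_gaussian_sqrt_mul_sqrt]
    have hF : Measurable (Function.uncurry fun (p : ℝ) (y : EuclideanSpace ℝ (Fin 4)) =>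
        ENNReal.ofReal (√(p ^ 2 + (‖y‖ ^ 2 - y k ^ 2)) * Real.exp (-p ^ 2)) *
          (ENNReal.ofReal (‖y‖ * Real.exp (-‖y‖ ^ 2)))) := by
      simp only [Function.uncurry_def]
      fun_prop
    have h := lintegral_euclideanSpace_succAbove (n := 4) i hF
    have hF2 : ∀ p : ℝ, Measurable (Function.uncurry fun (q : ℝ) (z : EuclideanSpace ℝ (Fin 3)) =>
        ENNReal.ofReal (√(p ^ 2 + ‖z‖ ^ 2) * Real.exp (-p ^ 2)) *
          (ENNReal.ofReal (√(q ^ 2 + ‖z‖ ^ 2) * Real.exp (-q ^ 2)) *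
            ENNReal.ofReal (Real.exp (-‖z‖ ^ 2)))) := fun p => by
      simp only [Function.uncurry_def]
      fun_prop
    calc _ = _ := by
          refine lintegral_congr fun x => ?_
          rw [← ENNReal.ofReal_mul (by positivity), norm_sq_eq_sq_add_norm_sq_succAbove i x,
            add_sub_cancel_left, Real.sqrt_sq (norm_nonneg _), neg_add, Real.exp_add,
            add_sub_assoc]
          congr 1
          ring
      _ = _ := h
      _ = _ := by
          refine lintegral_congr fun p => ?_
          rw [← lintegral_euclideanSpace_succAbove (n := 3) k (hF2 p)]
          refine lintegral_congr fun y => ?_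
          have hy := norm_sq_eq_sq_add_norm_sq_succAbove k y
          have hy' : ‖y‖ ^ 2 - y k ^ 2 = ‖WithLp.toLp 2 fun j => y (k.succAbove j)‖ ^ 2 := by
            rw [hy]
            ring
          rw [← hy, Real.sqrt_sq (norm_nonneg _), hy',
            ← ENNReal.ofReal_mul (p := ‖y‖ * _) (by positivity), mul_assoc ‖y‖, ← Real.exp_add,
            ← neg_add, ← hy]
  have hg7 : Real.Gamma (7 / 2) = 5 / 2 * Real.Gamma (5 / 2) := by
    rw [show (7 / 2 : ℝ) = 5 / 2 + 1 by norm_num, Real.Gamma_add_one (by norm_num)]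
  have hg5 : Real.Gamma (5 / 2) = 3 / 2 * Real.Gamma (3 / 2) := by
    rw [show (5 / 2 : ℝ) = 3 / 2 + 1 by norm_num, Real.Gamma_add_one (by norm_num)]
  have hg3 : 0 < Real.Gamma (3 / 2) := Real.Gamma_pos_of_pos (by norm_num)
  have h := integral_sphereUniform_eq (f := fun x : EuclideanSpace ℝ (Fin 5) =>
    √(‖x‖ ^ 2 - x i ^ 2) * √(‖x‖ ^ 2 - x (i.succAbove k) ^ 2)) (d := 2) (by fun_prop)
    (fun _ => by positivity)
    (fun r hr v => by
      rw [sqrt_norm_sq_sub_sq_smul i hr, sqrt_norm_sq_sub_sq_smul _ hr]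
      ring)
    (by rw [hg7, hg5]; positivity) hgauss
  simp only [norm_eq_of_mem_sphere, one_pow] at h
  rw [h, finrank_euclideanSpace, Fintype.card_fin]
  have h3 : Real.pi ^ (5 / 2 : ℝ) = Real.pi ^ (3 / 2 : ℝ) * Real.pi := by
    rw [← Real.rpow_add_one Real.pi_ne_zero]
    norm_num
  have hpi : 0 < Real.pi ^ (3 / 2 : ℝ) := Real.rpow_pos_of_pos Real.pi_pos _
  push_cast
  rw [show ((5 : ℝ) + 2) / 2 = 7 / 2 by norm_num, hg7, hg5, h3]
  field_simp
  ring

/-! ### Width of the shadow and the mean width formula. -/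

theorem norm_orthogonalProjectionOnto_sq {E : Type*} [NormedAddCommGroup E]
    [InnerProductSpace ℝ E] [FiniteDimensional ℝ E] {u : E} (hu : ‖u‖ = 1) (x : E) :
    ‖(Submodule.span ℝ {u})ᗮ.orthogonalProjectionOnto x‖ ^ 2 = ‖x‖ ^ 2 - inner ℝ u x ^ 2 := by
  have h := Submodule.norm_sq_eq_add_norm_sq_projection x (Submodule.span ℝ {u})
  rw [← Submodule.norm_coe (Submodule.orthogonalProjectionOnto _ x),
    Submodule.coe_orthogonalProjectionOnto_apply, Submodule.starProjection_unit_singleton ℝ hu,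
    norm_smul, hu, mul_one, Real.norm_eq_abs, sq_abs] at h
  linarith

theorem widthInDirection_cubeShadow {n : ℕ} (u : EuclideanSpace ℝ (Fin n))
    (v : (Submodule.span ℝ {u})ᗮ) :
    widthInDirection (cubeShadow u) v = ∑ i, |(v : EuclideanSpace ℝ (Fin n)) i| := by
  set y : EuclideanSpace ℝ (Fin n) := (v : EuclideanSpace ℝ (Fin n)) with hy
  have hinner : ∀ x : EuclideanSpace ℝ (Fin n), inner ℝ y x = ∑ i, y i * x i := fun x => by
    simp [PiLp.inner_apply, mul_comm]
  have himg : (fun x => inner ℝ v x) '' cubeShadow u = (fun x => inner ℝ y x) '' unitCube n := by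
    rw [cubeShadow, image_image]
    exact image_congr fun x _ => Submodule.inner_orthogonalProjectionOnto_eq_of_mem_left v x
  have hle : ∀ x ∈ unitCube n, |inner ℝ y x| ≤ (∑ i, |y i|) / 2 := fun x hx => by
    rw [hinner, Finset.sum_div]
    refine (Finset.abs_sum_le_sum_abs _ _).trans (Finset.sum_le_sum fun i _ => ?_)
    rw [abs_mul, div_eq_mul_one_div]
    exact mul_le_mul_of_nonneg_left (hx i) (abs_nonneg _)
  obtain ⟨x, hx, hxv⟩ : ∃ x ∈ unitCube n, inner ℝ y x = (∑ i, |y i|) / 2 := by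
    -- The maximum over the cube is attained by matching the signs of y; where y vanishes the
    -- coordinate 0 serves.
    refine ⟨WithLp.toLp 2 fun i => (SignType.sign (y i) : ℝ) / 2, fun i => ?_, ?_⟩
    · rcases lt_trichotomy (y i) 0 with h | h | h <;> norm_num [h]
    · rw [hinner, Finset.sum_div]
      refine Finset.sum_congr rfl fun i _ => ?_
      rw [← mul_div_assoc, self_mul_sign]
  have hmax : IsGreatest ((fun x => inner ℝ y x) '' unitCube n) ((∑ i, |y i|) / 2) :=
    ⟨⟨x, hx, hxv⟩, by
      rintro _ ⟨x, hx, rfl⟩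
      exact (abs_le.1 (hle x hx)).2⟩
  have hmin : IsLeast ((fun x => inner ℝ y x) '' unitCube n) (-((∑ i, |y i|) / 2)) :=
    ⟨⟨-x, fun i => by simpa using hx i, by simp only [inner_neg_right, hxv]⟩, by
      rintro _ ⟨x, hx, rfl⟩
      exact (abs_le.1 (hle x hx)).1⟩
  rw [widthInDirection, himg, hmax.csSup_eq, hmin.csInf_eq]
  ring

theorem shadowMeanWidth_eq (u : Metric.sphere (0 : EuclideanSpace ℝ (Fin 5)) 1) :
    shadowMeanWidth (u : EuclideanSpace ℝ (Fin 5)) =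
      4 / (3 * Real.pi) * ∑ j : Fin 5, √(1 - (u : EuclideanSpace ℝ (Fin 5)) j ^ 2) := by
  obtain ⟨u, hu⟩ := u
  have hu1 : ‖u‖ = 1 := by simpa using hu
  have hu0 : u ≠ 0 := by
    rintro rfl
    simp at hu1
  have : Fact (Module.finrank ℝ (EuclideanSpace ℝ (Fin 5)) = 4 + 1) := ⟨by simp⟩
  have hfin : Module.finrank ℝ (Submodule.span ℝ {u})ᗮ = 4 :=
    Submodule.finrank_orthogonal_span_singleton hu0
  have hnt : Nontrivial (Submodule.span ℝ {u})ᗮ :=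
    Module.nontrivial_of_finrank_pos (R := ℝ) (by omega)
  have hcoord : ∀ (v : (Submodule.span ℝ {u})ᗮ) (i : Fin 5),
      (v : EuclideanSpace ℝ (Fin 5)) i = inner ℝ v
        ((Submodule.span ℝ {u})ᗮ.orthogonalProjectionOnto (EuclideanSpace.single i 1)) :=
    fun v i => by
      rw [Submodule.inner_orthogonalProjectionOnto_eq_of_mem_left]
      simp [EuclideanSpace.inner_single_right]
  have hnorm : ∀ i : Fin 5, ‖(Submodule.span ℝ {u})ᗮ.orthogonalProjectionOnto
      (EuclideanSpace.single i (1 : ℝ))‖ = √(1 - u i ^ 2) := fun i => by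
    rw [← Real.sqrt_sq (norm_nonneg _), norm_orthogonalProjectionOnto_sq hu1]
    simp [EuclideanSpace.inner_single_right]
  rw [shadowMeanWidth, meanWidth]
  simp only [widthInDirection_cubeShadow, hcoord]
  rw [integral_finsetSum]
  · simp only [integral_abs_inner_sphereUniform hfin, hnorm, Finset.mul_sum]
  · intro i _
    refine Continuous.integrable_of_hasCompactSupport ?_ (HasCompactSupport.of_compactSpace _)
    fun_prop

/-! ### First and second moments. -/

theorem continuous_sqrt_one_sub_sq (i : Fin 5) :
    Continuous fun u : Metric.sphere (0 : EuclideanSpace ℝ (Fin 5)) 1 =>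
      √(1 - (u : EuclideanSpace ℝ (Fin 5)) i ^ 2) := by fun_prop

theorem sphere_sum_sq (u : Metric.sphere (0 : EuclideanSpace ℝ (Fin 5)) 1) :
    ∑ i, (u : EuclideanSpace ℝ (Fin 5)) i ^ 2 = 1 := by
  rw [← EuclideanSpace.real_norm_sq_eq, norm_eq_of_mem_sphere, one_pow]

theorem sphere_one_sub_sq_nonneg (u : Metric.sphere (0 : EuclideanSpace ℝ (Fin 5)) 1)
    (i : Fin 5) : 0 ≤ 1 - (u : EuclideanSpace ℝ (Fin 5)) i ^ 2 := by
  simpa using norm_sq_sub_sq_nonneg i (u : EuclideanSpace ℝ (Fin 5))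

theorem integral_shadowMeanWidth :
    ∫ u : Metric.sphere (0 : EuclideanSpace ℝ (Fin 5)) 1,
      shadowMeanWidth (u : EuclideanSpace ℝ (Fin 5))
        ∂(sphereUniform (EuclideanSpace ℝ (Fin 5))) = 15 / 8 := by
  simp only [shadowMeanWidth_eq]
  rw [integral_const_mul, integral_finsetSum]
  · simp only [integral_sqrt_one_sub_sq_sphereUniform, Finset.sum_const, Finset.card_univ,
      Fintype.card_fin, nsmul_eq_mul]
    have := Real.pi_ne_zero
    push_cast
    field_simp
    norm_num
  · exact fun i _ => (continuous_sqrt_one_sub_sq i).integrable_of_hasCompactSupport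
      (HasCompactSupport.of_compactSpace _)

theorem integral_shadowMeanWidth_sq :
    ∫ u : Metric.sphere (0 : EuclideanSpace ℝ (Fin 5)) 1,
      shadowMeanWidth (u : EuclideanSpace ℝ (Fin 5)) ^ 2
        ∂(sphereUniform (EuclideanSpace ℝ (Fin 5))) =
      16 / (9 * Real.pi ^ 2) * (4 + 20 * ((9 / 40 * coshIntegral (3 / 2) ^ 2 +
        1 / 24 * coshIntegral (1 / 2) ^ 2) / Real.pi)) := by
  have hpt : ∀ u : Metric.sphere (0 : EuclideanSpace ℝ (Fin 5)) 1,
      shadowMeanWidth (u : EuclideanSpace ℝ (Fin 5)) ^ 2 = 16 / (9 * Real.pi ^ 2) *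
        (4 + ∑ i, ∑ j ∈ Finset.univ.erase i, √(1 - (u : EuclideanSpace ℝ (Fin 5)) i ^ 2) *
          √(1 - (u : EuclideanSpace ℝ (Fin 5)) j ^ 2)) := fun u => by
    -- The diagonal of the squared sum is constant, 5 - 1 = 4; the 20 ordered off-diagonal pairs all
    -- have the same mean.
    have h4 : ∑ i, √(1 - (u : EuclideanSpace ℝ (Fin 5)) i ^ 2) *
        √(1 - (u : EuclideanSpace ℝ (Fin 5)) i ^ 2) = 4 := by
      simp only [Real.mul_self_sqrt (sphere_one_sub_sq_nonneg u _), Finset.sum_sub_distrib,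
        sphere_sum_sq]
      norm_num
    have hsq : ∑ i, ∑ j, √(1 - (u : EuclideanSpace ℝ (Fin 5)) i ^ 2) *
        √(1 - (u : EuclideanSpace ℝ (Fin 5)) j ^ 2) =
        4 + ∑ i, ∑ j ∈ Finset.univ.erase i, √(1 - (u : EuclideanSpace ℝ (Fin 5)) i ^ 2) *
          √(1 - (u : EuclideanSpace ℝ (Fin 5)) j ^ 2) := by
      rw [← h4, ← Finset.sum_add_distrib]
      exact Finset.sum_congr rfl fun i _ => (Finset.add_sum_erase _
        (fun j => √(1 - (u : EuclideanSpace ℝ (Fin 5)) i ^ 2) *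
          √(1 - (u : EuclideanSpace ℝ (Fin 5)) j ^ 2)) (Finset.mem_univ i)).symm
    rw [shadowMeanWidth_eq, mul_pow, sq (∑ j, _), Finset.sum_mul_sum, hsq]
    congr 1
    ring
  have hint : ∀ i j : Fin 5, Integrable (fun u : Metric.sphere (0 : EuclideanSpace ℝ (Fin 5)) 1 =>
      √(1 - (u : EuclideanSpace ℝ (Fin 5)) i ^ 2) * √(1 - (u : EuclideanSpace ℝ (Fin 5)) j ^ 2))
      (sphereUniform (EuclideanSpace ℝ (Fin 5))) := fun i j =>
    ((continuous_sqrt_one_sub_sq i).mul (continuous_sqrt_one_sub_sq j)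
      ).integrable_of_hasCompactSupport (HasCompactSupport.of_compactSpace _)
  simp only [hpt]
  rw [integral_const_mul, integral_add (integrable_const _)
    (integrable_finsetSum _ fun i _ => integrable_finsetSum _ fun j _ => hint i j),
    integral_finsetSum _ fun i _ => integrable_finsetSum _ fun j _ => hint i j]
  congr 2
  · simp
  · have : ∀ i : Fin 5, ∫ u : Metric.sphere (0 : EuclideanSpace ℝ (Fin 5)) 1,
        ∑ j ∈ Finset.univ.erase i, √(1 - (u : EuclideanSpace ℝ (Fin 5)) i ^ 2) *
          √(1 - (u : EuclideanSpace ℝ (Fin 5)) j ^ 2)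
          ∂(sphereUniform (EuclideanSpace ℝ (Fin 5))) =
        4 * ((9 / 40 * coshIntegral (3 / 2) ^ 2 + 1 / 24 * coshIntegral (1 / 2) ^ 2) /
          Real.pi) := fun i => by
      rw [integral_finsetSum _ fun j _ => hint i j, Finset.sum_congr rfl fun j hj =>
        integral_sqrt_mul_sqrt_sphereUniform (Finset.ne_of_mem_erase hj).symm]
      simp [Finset.card_erase_of_mem]
    simp only [this, Finset.sum_const, Finset.card_univ, Fintype.card_fin, nsmul_eq_mul]
    push_cast
    ring

/-! ### Gamma values at quarters and the numerical bound. -/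

theorem Gamma_quarter_mul_Gamma_three_quarters :
    Real.Gamma (1 / 4) * Real.Gamma (3 / 4) = Real.pi * √2 := by
  have h := Real.Gamma_mul_Gamma_one_sub (1 / 4)
  rw [show (1 : ℝ) - 1 / 4 = 3 / 4 by norm_num, show Real.pi * (1 / 4) = Real.pi / 4 by ring,
    Real.sin_pi_div_four] at h
  rw [h]
  have : √2 ≠ 0 := by positivity
  field_simp
  rw [Real.sq_sqrt (by norm_num)]

theorem coshIntegral_half_sq :
    2 * Real.pi * coshIntegral (1 / 2) ^ 2 = Real.Gamma (1 / 4) ^ 4 := by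
  have h := Gamma_quarter_mul_Gamma_three_quarters
  have h3 : 0 < Real.Gamma (3 / 4) := Real.Gamma_pos_of_pos (by norm_num)
  have h1 : 0 < Real.Gamma (1 / 4) := Real.Gamma_pos_of_pos (by norm_num)
  rw [coshIntegral, show (1 / 2 / 2 : ℝ) = 1 / 4 by norm_num,
    show ((1 / 2 + 1) / 2 : ℝ) = 3 / 4 by norm_num, div_pow, mul_pow,
    Real.sq_sqrt Real.pi_pos.le]
  have h2 : (Real.Gamma (1 / 4) * Real.Gamma (3 / 4)) ^ 2 = 2 * Real.pi ^ 2 := by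
    rw [h, mul_pow, Real.sq_sqrt (by norm_num)]
    ring
  field_simp
  linear_combination -h2

theorem coshIntegral_half_mul_three_halves :
    coshIntegral (1 / 2) * coshIntegral (3 / 2) = 4 * Real.pi := by
  have h3 : 0 < Real.Gamma (3 / 4) := Real.Gamma_pos_of_pos (by norm_num)
  have h1 : 0 < Real.Gamma (1 / 4) := Real.Gamma_pos_of_pos (by norm_num)
  rw [coshIntegral, coshIntegral, show (1 / 2 / 2 : ℝ) = 1 / 4 by norm_num,
    show ((1 / 2 + 1) / 2 : ℝ) = 3 / 4 by norm_num, show (3 / 2 / 2 : ℝ) = 3 / 4 by norm_num,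
    show ((3 / 2 + 1) / 2 : ℝ) = 1 / 4 + 1 by norm_num, Real.Gamma_add_one (by norm_num)]
  field_simp
  rw [Real.sq_sqrt Real.pi_pos.le]

theorem Gamma_midpoint_sq_le {s t : ℝ} (hs : 0 < s) (ht : 0 < t) :
    Real.Gamma ((s + t) / 2) ^ 2 ≤ Real.Gamma s * Real.Gamma t := by
  have h := Real.Gamma_mul_add_mul_le_rpow_Gamma_mul_rpow_Gamma hs ht
    (a := 1 / 2) (b := 1 / 2) (by norm_num) (by norm_num) (by norm_num)
  rw [← Real.sqrt_eq_rpow, ← Real.sqrt_eq_rpow, ← Real.sqrt_mul (Real.Gamma_pos_of_pos hs).le] at h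
  rw [show (s + t) / 2 = 1 / 2 * s + 1 / 2 * t by ring]
  have hst : 0 < Real.Gamma (1 / 2 * s + 1 / 2 * t) := Real.Gamma_pos_of_pos (by positivity)
  exact (Real.le_sqrt' hst).1 h

/-- Log-convexity is applied at 9/4, between 2 and 5/2, and carried back to 1/4 by the functional
equation. -/
theorem Gamma_quarter_pow_four_le : Real.Gamma (1 / 4) ^ 4 ≤ (192 / 25) ^ 2 * Real.pi := by
  have h := Gamma_midpoint_sq_le (s := 2) (t := 5 / 2) (by norm_num) (by norm_num)
  rw [show ((2 + 5 / 2) / 2 : ℝ) = 1 / 4 + 1 + 1 by norm_num, Real.Gamma_add_one (by norm_num),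
    Real.Gamma_add_one (by norm_num), Gamma_five_half, Real.Gamma_two] at h
  have h2 : Real.Gamma (1 / 4) ^ 2 ≤ 192 / 25 * √Real.pi := by nlinarith
  calc Real.Gamma (1 / 4) ^ 4 = (Real.Gamma (1 / 4) ^ 2) ^ 2 := by ring
    _ ≤ (192 / 25 * √Real.pi) ^ 2 := by gcongr
    _ = _ := by rw [mul_pow, Real.sq_sqrt Real.pi_pos.le]

/-- Log-convexity at 11/4 bounds Γ(3/4) from above; the reflection formula turns this into a lower
bound for Γ(1/4). -/
theorem le_Gamma_quarter_pow_four :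
    4 * (147 / 128) ^ 2 * Real.pi ^ 3 ≤ Real.Gamma (1 / 4) ^ 4 := by
  have h := Gamma_midpoint_sq_le (s := 5 / 2) (t := 3) (by norm_num) (by norm_num)
  have hG3 : Real.Gamma 3 = 2 := by simp
  rw [show ((5 / 2 + 3) / 2 : ℝ) = 3 / 4 + 1 + 1 by norm_num, Real.Gamma_add_one (by norm_num),
    Real.Gamma_add_one (by norm_num), Gamma_five_half, hG3] at h
  have h3 : 0 < Real.Gamma (3 / 4) := Real.Gamma_pos_of_pos (by norm_num)
  have h2 : Real.Gamma (3 / 4) ^ 2 ≤ 128 / 147 * √Real.pi := by nlinarith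
  have h4 : Real.Gamma (3 / 4) ^ 4 ≤ (128 / 147) ^ 2 * Real.pi := by
    calc Real.Gamma (3 / 4) ^ 4 = (Real.Gamma (3 / 4) ^ 2) ^ 2 := by ring
      _ ≤ (128 / 147 * √Real.pi) ^ 2 := by gcongr
      _ = _ := by rw [mul_pow, Real.sq_sqrt Real.pi_pos.le]
  have hp : Real.Gamma (1 / 4) ^ 4 * Real.Gamma (3 / 4) ^ 4 = 4 * Real.pi ^ 4 := by
    rw [← mul_pow, Gamma_quarter_mul_Gamma_three_quarters, mul_pow,
      show √2 ^ 4 = (√2 ^ 2) ^ 2 by ring, Real.sq_sqrt (by norm_num)]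
    ring
  have hpi := Real.pi_pos
  refine le_of_mul_le_mul_right ?_ (show 0 < (128 / 147) ^ 2 * Real.pi by positivity)
  calc 4 * (147 / 128) ^ 2 * Real.pi ^ 3 * ((128 / 147) ^ 2 * Real.pi) = 4 * Real.pi ^ 4 := by ring
    _ = Real.Gamma (1 / 4) ^ 4 * Real.Gamma (3 / 4) ^ 4 := hp.symm
    _ ≤ _ := by gcongr

theorem second_moment_value_lt :
    16 / (9 * Real.pi ^ 2) * (4 + 20 * ((9 / 40 * coshIntegral (3 / 2) ^ 2 +
        1 / 24 * coshIntegral (1 / 2) ^ 2) / Real.pi)) < 1 + 8 / Real.pi := by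
  have hpi := Real.pi_pos
  have hpi1 := Real.pi_gt_d2
  have hpi2 := Real.pi_lt_d2
  have c1 := coshIntegral_pos (a := 1 / 2) (by norm_num)
  have hA := coshIntegral_half_sq
  have hAB := coshIntegral_half_mul_three_halves
  have hB : coshIntegral (3 / 2) = 4 * Real.pi / coshIntegral (1 / 2) := by
    field_simp
    linarith
  -- In this variable the two squares are 4πx and 4π/x, so only 18/x + 10x/3 has to be bounded.
  obtain ⟨x, hx⟩ : ∃ x, x = coshIntegral (1 / 2) ^ 2 / (4 * Real.pi) := ⟨_, rfl⟩
  have hx0 : 0 < x := by rw [hx]; positivity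
  have hxA : coshIntegral (1 / 2) ^ 2 = 4 * Real.pi * x := by rw [hx]; field_simp
  have hxB : coshIntegral (3 / 2) ^ 2 = 4 * Real.pi / x := by
    rw [hB, div_pow, hxA]
    field_simp
  have hupper : x ≤ 236 / 100 := by
    have h := Gamma_quarter_pow_four_le
    rw [← hA, hxA] at h
    have h2 : 8 * Real.pi * x ≤ (192 / 25) ^ 2 := by
      refine le_of_mul_le_mul_right ?_ hpi
      linarith
    nlinarith
  have hlower : 207 / 100 ≤ x := by
    have h := le_Gamma_quarter_pow_four
    rw [← hA, hxA] at h
    have h2 : 4 * (147 / 128) ^ 2 * Real.pi ≤ 8 * x := by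
      refine le_of_mul_le_mul_right ?_ (pow_pos hpi 2)
      linarith
    linarith
  -- The left side is convex in x, so its maximum on [2.07, 2.36] is at an endpoint; the larger
  -- value is about 15.596, at 2.07.
  have hval : 18 / x + 10 / 3 * x ≤ 156 / 10 := by
    rw [div_add' _ _ _ hx0.ne', div_le_iff₀ hx0]
    nlinarith
  rw [hxA, hxB, show 4 + 20 * ((9 / 40 * (4 * Real.pi / x) + 1 / 24 * (4 * Real.pi * x)) / Real.pi)
    = 4 + (18 / x + 10 / 3 * x) by field_simp; ring,
    show 1 + 8 / Real.pi = 16 / (9 * Real.pi ^ 2) * (9 / 16 * Real.pi ^ 2 + 9 / 2 * Real.pi) by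
      field_simp; ring]
  refine mul_lt_mul_of_pos_left ?_ (by positivity)
  -- What remains is 19.6 < 9π²/16 + 9π/2, which already holds with 3.14 in place of π.
  nlinarith

/-! ### Extreme values. -/

theorem isGreatest_shadowMeanWidth :
    IsGreatest (Set.range fun u : Metric.sphere (0 : EuclideanSpace ℝ (Fin 5)) 1 =>
      shadowMeanWidth (u : EuclideanSpace ℝ (Fin 5))) (8 * √5 / (3 * Real.pi)) := by
  have hpi := Real.pi_pos
  have h5 : 0 < √(5 : ℝ) := by positivity
  have h55 : √(5 : ℝ) ^ 2 = 5 := Real.sq_sqrt (by norm_num)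
  constructor
  · refine ⟨⟨WithLp.toLp 2 fun _ => (√5)⁻¹, ?_⟩, ?_⟩
    · rw [mem_sphere_zero_iff_norm, EuclideanSpace.norm_eq]
      simp [h55]
    · refine (shadowMeanWidth_eq _).trans ?_
      simp only [inv_pow, h55]
      rw [show (1 - 5⁻¹ : ℝ) = 2 ^ 2 / 5 by norm_num, Real.sqrt_div (by norm_num),
        Real.sqrt_sq (by norm_num)]
      simp only [Finset.sum_const, Finset.card_univ, Fintype.card_fin, nsmul_eq_mul]
      push_cast
      field_simp
      rw [h55]
      norm_num
  · rintro _ ⟨u, rfl⟩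
    simp only [shadowMeanWidth_eq]
    -- The squares of the roots sum to 4, so Cauchy–Schwarz bounds the squared sum by 5 · 4 = 20;
    -- equal coordinates give equality.
    have hcs := sq_sum_le_card_mul_sum_sq (s := Finset.univ)
      (f := fun i => √(1 - (u : EuclideanSpace ℝ (Fin 5)) i ^ 2))
    simp only [Real.sq_sqrt (sphere_one_sub_sq_nonneg u _), Finset.sum_sub_distrib,
        sphere_sum_sq] at hcs
    have hle : ∑ i, √(1 - (u : EuclideanSpace ℝ (Fin 5)) i ^ 2) ≤ 2 * √5 := by
      refine abs_le_of_sq_le_sq' ?_ (by positivity) |>.2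
      rw [mul_pow, h55]
      refine hcs.trans ?_
      norm_num
    calc _ ≤ 4 / (3 * Real.pi) * (2 * √5) := by gcongr
      _ = _ := by ring

theorem isLeast_shadowMeanWidth :
    IsLeast (Set.range fun u : Metric.sphere (0 : EuclideanSpace ℝ (Fin 5)) 1 =>
      shadowMeanWidth (u : EuclideanSpace ℝ (Fin 5))) (16 / (3 * Real.pi)) := by
  have hpi := Real.pi_pos
  constructor
  · refine ⟨⟨EuclideanSpace.single 0 1, by simp⟩, ?_⟩
    refine (shadowMeanWidth_eq _).trans ?_
    simp [Fin.sum_univ_succ]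
    ring
  · rintro _ ⟨u, rfl⟩
    simp only [shadowMeanWidth_eq]
    -- Each 1 - u i ^ 2 lies in [0, 1], where the root dominates the number; coordinate vectors give
    -- equality.
    have hle : 4 ≤ ∑ i, √(1 - (u : EuclideanSpace ℝ (Fin 5)) i ^ 2) := by
      calc (4 : ℝ) = ∑ i, (1 - (u : EuclideanSpace ℝ (Fin 5)) i ^ 2) := by
            rw [Finset.sum_sub_distrib, sphere_sum_sq]
            norm_num
        _ ≤ _ := Finset.sum_le_sum fun i _ => Real.le_sqrt_of_sq_le (by
            nlinarith [sphere_one_sub_sq_nonneg u i,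
              sq_nonneg ((u : EuclideanSpace ℝ (Fin 5)) i)])
    calc 16 / (3 * Real.pi) = 4 / (3 * Real.pi) * 4 := by ring
      _ ≤ _ := by gcongr


end

theorem mainTheorem7 :
    -- the mean width of the projection of the 5-cube onto the hyperplane orthogonal to `u`
    (∀ u : Metric.sphere (0 : EuclideanSpace ℝ (Fin 5)) 1,
      shadowMeanWidth (u : EuclideanSpace ℝ (Fin 5)) =
        4 / (3 * Real.pi) * ∑ j : Fin 5, √(1 - (u : EuclideanSpace ℝ (Fin 5)) j ^ 2)) ∧
    -- its first moment, for `u` uniformly distributed on the unit sphere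
    ∫ u : Metric.sphere (0 : EuclideanSpace ℝ (Fin 5)) 1,
        shadowMeanWidth (u : EuclideanSpace ℝ (Fin 5))
          ∂(sphereUniform (EuclideanSpace ℝ (Fin 5))) = 15 / 8 ∧
    -- its second moment; both hypergeometric series converge
    Summable (hyp3F2Term (-1 / 2) (1 / 2) (3 / 2) 1 2 1) ∧
    Summable (hyp3F2Term (-1 / 2) (1 / 2) (3 / 2) 1 3 1) ∧
    ∫ u : Metric.sphere (0 : EuclideanSpace ℝ (Fin 5)) 1,
        shadowMeanWidth (u : EuclideanSpace ℝ (Fin 5)) ^ 2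
          ∂(sphereUniform (EuclideanSpace ℝ (Fin 5))) =
      4 / (81 * Real.pi ^ 4) *
        (144 * Real.pi ^ 2 - 10 * Real.Gamma (1 / 4) ^ 4 +
          45 * Real.pi ^ 3 *
            (8 * hyp3F2 (-1 / 2) (1 / 2) (3 / 2) 1 2 1 -
              hyp3F2 (-1 / 2) (1 / 2) (3 / 2) 1 3 1)) ∧
    ∫ u : Metric.sphere (0 : EuclideanSpace ℝ (Fin 5)) 1,
        shadowMeanWidth (u : EuclideanSpace ℝ (Fin 5)) ^ 2
          ∂(sphereUniform (EuclideanSpace ℝ (Fin 5))) < 1 + 8 / Real.pi ∧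
    -- the extreme values of the mean width
    IsGreatest (Set.range fun u : Metric.sphere (0 : EuclideanSpace ℝ (Fin 5)) 1 =>
      shadowMeanWidth (u : EuclideanSpace ℝ (Fin 5))) (8 * √5 / (3 * Real.pi)) ∧
    IsLeast (Set.range fun u : Metric.sphere (0 : EuclideanSpace ℝ (Fin 5)) 1 =>
      shadowMeanWidth (u : EuclideanSpace ℝ (Fin 5))) (16 / (3 * Real.pi)) := by
  refine ⟨shadowMeanWidth_eq, integral_shadowMeanWidth, summable_hyp3F2Term_one_two,
    summable_hyp3F2Term_one_three, ?_, ?_, isGreatest_shadowMeanWidth, isLeast_shadowMeanWidth⟩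
  · have hpi := Real.pi_ne_zero
    rw [integral_shadowMeanWidth_sq, eight_mul_hyp3F2_sub_hyp3F2, ← coshIntegral_half_sq]
    field_simp
    ring
  · rw [integral_shadowMeanWidth_sq]
    exact second_moment_value_lt
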